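/- Let $m,n\ge 1$ be integers and let $|\cdot|$ denote the supremum norm. Let $A\subseteq\mathbb{Z}^n$ be a lattice of integer vectors (an additive subgroup of $\mathbb{Z}^n$) whose real linear span has dimension $u$, $0\le u\le n$. Let $\mathrm{Bad}_A(m,n)$ be the set of real $m\times n$ matrices $X\in\mathbb{R}^{mn}$ for which there exists a constant $C(X)>0$ such that $$|\mathbf{q}X-\mathbf{p}|>C(X)\,|\mathbf{q}|^{-\frac{m+u}{n}+1}\qquad\text{for all }\mathbf{p}\in A\text{ and all }\mathbf{q}\in\mathbb{Z}^m\setminus\{\mathbf{0}\}.$$ Then the Hausdorff dimension of $\mathrm{Bad}_A(m,n)$ is $mn$. If moreover $m+u\le n$, then $\mathrm{Bad}_A(m,n)$ has full Lebesgue measure in $\mathbb{R}^{mn}$ (its complement is a null set), and for Lebesgue-almost every $X\in\mathbb{R}^{mn}$ there even exists a constant $C(X)>0$ such that $|\mathbf{q}X-\mathbf{p}|>C(X)\,|\mathbf{q}|$ for all $\mathbf{p}\in A$ and all $\mathbf{q}\in\mathbb{Z}^m\setminus\{\mathbf{0}\}$. In particular (the case $A=\{\mathbf{0}\}$, $u=0$),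 for all $m,n\ge1$ the set $\mathrm{Bad}^*(m,n)$ of those $X\in[0,1]^{mn}$ for which there exists $C(X)>0$ with $|\mathbf{q}X|>C(X)\,|\mathbf{q}|^{-\frac{m}{n}+1}$ for all $\mathbf{q}\in\mathbb{Z}^m\setminus\{\mathbf{0}\}$ has Hausdorff dimension $mn$. -/

import Mathlib

open MeasureTheory

/-- The vector `𝐪X - 𝐩 ∈ ℝⁿ`, for an `m × n` real matrix `X`, a row vector `𝐪 ∈ ℤᵐ` and `𝐩 ∈ ℤⁿ`.
The space of matrices is `Fin m → Fin n → ℝ`, so that it carries the usual (supremum) metric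
and Lebesgue measure on `ℝ^{mn}`. -/
noncomputable def linForms {m n : ℕ} (X : Fin m → Fin n → ℝ) (p : Fin n → ℤ) (q : Fin m → ℤ) :
    Fin n → ℝ :=
  Matrix.vecMul (fun i => (q i : ℝ)) (Matrix.of X) - fun j => (p j : ℝ)

/-- The dimension `u` of the real linear subspace of `ℝⁿ` spanned by a lattice `A` of
integer vectors. -/
noncomputable def latticeDim {n : ℕ} (A : AddSubgroup (Fin n → ℤ)) : ℕ :=
  Module.finrank ℝ
    (Submodule.span ℝ ((fun (v : Fin n → ℤ) (j : Fin n) => (v j : ℝ)) '' (A : Set (Fin n → ℤ))))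

/-- `Bad_A(m,n)`: the `m × n` real matrices `X` for which there is a constant `C(X) > 0` with
`|𝐪X - 𝐩| > C(X) |𝐪|^{-(m+u)/n + 1}` for all `𝐩 ∈ A` and `𝐪 ∈ ℤᵐ \ {0}`, where `u` is the dimension
of the span of `A`, and `|·|` is the supremum norm (the norm of `Fin k → ℝ` and `Fin k → ℤ`). -/
def BadA (m n : ℕ) (A : AddSubgroup (Fin n → ℤ)) : Set (Fin m → Fin n → ℝ) :=
  {X | ∃ C : ℝ, 0 < C ∧ ∀ p ∈ A, ∀ q : Fin m → ℤ, q ≠ 0 →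
    C * ‖q‖ ^ (-(((m : ℝ) + (latticeDim A : ℝ)) / (n : ℝ)) + 1) < ‖linForms X p q‖}

/-- `Bad*(m,n)`: the matrices `X ∈ [0,1]^{mn}` for which there is a constant `C(X) > 0` with
`|𝐪X| > C(X) |𝐪|^{-m/n + 1}` for all `𝐪 ∈ ℤᵐ \ {0}`. -/
def BadStar (m n : ℕ) : Set (Fin m → Fin n → ℝ) :=
  {X | (∀ i j, X i j ∈ Set.Icc (0 : ℝ) 1) ∧ ∃ C : ℝ, 0 < C ∧ ∀ q : Fin m → ℤ, q ≠ 0 →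
    C * ‖q‖ ^ (-((m : ℝ) / (n : ℝ)) + 1) < ‖Matrix.vecMul (fun i => (q i : ℝ)) (Matrix.of X)‖}

/-!
The statement splits according to whether `m + u ≤ n`.

If `m + u ≤ n`, then for almost every `X` the row space of `X` has dimension `m` and meets the span
of `A` only in `0` (`ae_exists_mul_norm_lt`: a determinant vanishes on a null set only), so
`|qX - p|` is bounded below by a multiple of `|q|`. Positive volume gives full dimension.

If `m + u > n`, choose linear coordinates on `ℝⁿ = ℝ^u × ℝ^r` in which `A` consists of integer
vectors of `ℝ^u` (`exists_latticeCoordinates`), and write `X` as `r` rows followed by `M = m - r`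
rows. For `X = blockMatrix y z`, where the rows `y` are close to the unit vectors of `ℝ^r`, the
vector `qX - p` is comparable to a classical form `q'' z - p'` with `p' ∈ ℤⁿ` arbitrary
(`sum_mul_blockMatrix_sub`). Hence it suffices that the set of badly approximable `M × n` matrices
`z` has full dimension, in a form that allows the free parameters `y` to be carried along.

This is proved by following the lattice of `z` under the diagonal flow on `ℝⁿ × ℝ^M`. A lattice in
dimension `d` is called thick (`IsThick`) if its subgroups of rank `i` have covolume at least
`ε ^ (i (d - i))`, covolumes being measured by largest minors (`maxMinor`). If all lattices on the
trajectory are thick, then `z` is badly approximable (`badlyApproximable_of_isThick`), as in Dani's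
correspondence. The digits of `z` in a large base govern the successive steps, and at least half of
the choices of digits lead from a thick lattice to a thick lattice (`exists_isThick_half`), for two
reasons:

* A given subgroup of intermediate rank is shrunk by few choices only (`card_shrinking_le`). Its
  minors are multi-affine in the digits, hence rarely small, and the flow expands those minors which
  involve the expanded rows.
* In each rank at most one subspace matters (`IsThick.exists_eq_mul`). Covolumes are submodular
  (`maxMinor_submodular`) and the exponents `i (d - i)` are strictly concave, so that for two
  different subspaces of nearly minimal covolume, the sum or the intersection would be too small.

The limits of the paths of the resulting tree are mapped onto `[0, 1]` by a Hölder continuous map,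
which bounds the dimension from below (`le_dimH_of_tree`). The loss of constant factors in the
number of choices is negligible when the base tends to infinity (`le_dimH_badFamily`).
-/

/-! ### Maximal minors as covolumes -/

/-- The largest absolute value of a maximal minor of `W`, the rows being chosen by an arbitrary
map `S` (a map that is not injective contributes `0`). It serves as the covolume of the
subgroup spanned by the columns of `W`. -/
noncomputable def maxMinor {κ ι : Type*} [Fintype ι] [DecidableEq ι] (W : Matrix κ ι ℝ) : ℝ :=
  ⨆ S : ι → κ, |(W.submatrix S id).det|

section MaxMinor

variable {κ ι : Type*} [Fintype ι] [DecidableEq ι]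

lemma abs_det_submatrix_le_maxMinor [Finite κ] (W : Matrix κ ι ℝ) (S : ι → κ) :
    |(W.submatrix S id).det| ≤ maxMinor W :=
  le_ciSup (f := fun S : ι → κ => |(W.submatrix S id).det|) (Set.finite_range _).bddAbove S

lemma maxMinor_nonneg (W : Matrix κ ι ℝ) : 0 ≤ maxMinor W :=
  Real.iSup_nonneg fun _ => abs_nonneg _

lemma maxMinor_le {W : Matrix κ ι ℝ} {c : ℝ} (hc : 0 ≤ c)
    (h : ∀ S : ι → κ, |(W.submatrix S id).det| ≤ c) : maxMinor W ≤ c :=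
  Real.iSup_le h hc

lemma exists_abs_det_eq_maxMinor [Finite κ] [Nonempty κ] (W : Matrix κ ι ℝ) :
    ∃ S : ι → κ, |(W.submatrix S id).det| = maxMinor W :=
  exists_eq_ciSup_of_finite

lemma maxMinor_mul_right (W : Matrix κ ι ℝ) (G : Matrix ι ι ℝ) :
    maxMinor (W * G) = maxMinor W * |G.det| := by
  unfold maxMinor
  rw [Real.iSup_mul_of_nonneg (abs_nonneg _)]
  refine iSup_congr fun S => ?_
  rw [← abs_mul, ← Matrix.det_mul]
  rfl

lemma maxMinor_submatrix_equiv {ι' : Type*} [Fintype ι'] [DecidableEq ι'] (e : ι' ≃ ι)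
    (W : Matrix κ ι ℝ) : maxMinor (W.submatrix id e) = maxMinor W := by
  unfold maxMinor
  refine Equiv.iSup_congr (e.arrowCongr (Equiv.refl κ)) fun S => ?_
  congr 1
  rw [← Matrix.det_submatrix_equiv_self e]
  congr 1
  ext a b
  simp

lemma maxMinor_mul_left_le {κ' : Type*} [Fintype κ] [DecidableEq κ] (C : Matrix κ' κ ℝ)
    (W : Matrix κ ι ℝ) {c : ℝ} (hc : ∀ k, ∑ l, |C k l| ≤ c) (hc0 : 0 ≤ c) :
    maxMinor (C * W) ≤ c ^ Fintype.card ι * maxMinor W := by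
  refine maxMinor_le (mul_nonneg (pow_nonneg hc0 _) (maxMinor_nonneg W)) fun S => ?_
  have h1 : ((C * W).submatrix S id).det
      = ∑ φ : ι → κ, (∏ a, C (S a) (φ a)) * (W.submatrix φ id).det := by
    have h2 : (C * W).submatrix S id = fun a => ∑ l, C (S a) l • W l := by
      ext a b
      simp [Matrix.mul_apply, Finset.sum_apply]
    have h3 := (Matrix.detRowAlternating (n := ι) (R := ℝ)).toMultilinearMap.map_sum
      (fun a (l : κ) => C (S a) l • W l)
    rw [h2]
    refine (h3.trans ?_)
    refine Finset.sum_congr rfl fun φ _ => ?_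
    rw [MultilinearMap.map_smul_univ]
    rfl
  rw [h1]
  calc |∑ φ : ι → κ, (∏ a, C (S a) (φ a)) * (W.submatrix φ id).det|
      ≤ ∑ φ : ι → κ, |(∏ a, C (S a) (φ a)) * (W.submatrix φ id).det| :=
        Finset.abs_sum_le_sum_abs _ _
    _ ≤ ∑ φ : ι → κ, (∏ a, |C (S a) (φ a)|) * maxMinor W := by
        refine Finset.sum_le_sum fun φ _ => ?_
        rw [abs_mul, Finset.abs_prod]
        exact mul_le_mul_of_nonneg_left (abs_det_submatrix_le_maxMinor W φ)
          (Finset.prod_nonneg fun _ _ => abs_nonneg _)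
    _ = (∏ a, ∑ l, |C (S a) l|) * maxMinor W := by
        rw [← Finset.sum_mul, Finset.prod_univ_sum]
        simp
    _ ≤ c ^ Fintype.card ι * maxMinor W := by
        refine mul_le_mul_of_nonneg_right ?_ (maxMinor_nonneg W)
        refine (Finset.prod_le_prod (fun _ _ => Finset.sum_nonneg fun _ _ => abs_nonneg _)
          fun a _ => hc (S a)).trans ?_
        simp

/-- By Cramer's rule, the columns of `W` can be replaced by a basis of their span which is the
identity on the rows of a maximal minor and whose other entries are at most `1`. -/
lemma exists_normalForm [Finite κ] [Nonempty κ] {W : Matrix κ ι ℝ} (hW : 0 < maxMinor W) :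
    ∃ (S : ι → κ) (Z : Matrix κ ι ℝ), |(W.submatrix S id).det| = maxMinor W ∧
      W = Z * W.submatrix S id ∧ Z.submatrix S id = 1 ∧ ∀ k b, |Z k b| ≤ 1 := by
  obtain ⟨S, hS⟩ := exists_abs_det_eq_maxMinor W
  set D := W.submatrix S id with hD
  have hdet : D.det ≠ 0 := by
    intro h
    rw [h, abs_zero] at hS
    exact hW.ne hS
  have hu : IsUnit D.det := isUnit_iff_ne_zero.mpr hdet
  have hWZ : W = W * D⁻¹ * D := by rw [Matrix.mul_assoc, Matrix.nonsing_inv_mul D hu, Matrix.mul_one]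
  have hZS : (W * D⁻¹).submatrix S id = 1 := by
    have : (W * D⁻¹).submatrix S id = D * D⁻¹ := rfl
    rw [this, Matrix.mul_nonsing_inv D hu]
  have hM : maxMinor (W * D⁻¹) = 1 := by
    have := maxMinor_mul_right (W * D⁻¹) D
    rw [← hWZ, hS] at this
    exact (mul_right_cancel₀ hW.ne' (by rw [one_mul]; exact this)).symm
  refine ⟨S, W * D⁻¹, hS, hWZ, hZS, fun k b => ?_⟩
  have h1 : ((W * D⁻¹).submatrix (Function.update S b k) id)
      = (1 : Matrix ι ι ℝ).updateRow b ((W * D⁻¹) k) := by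
    ext a c
    by_cases hab : a = b
    · subst hab
      simp
    · rw [Matrix.updateRow_ne hab, ← hZS]
      simp [Function.update_of_ne hab]
  have h2 : ((W * D⁻¹).submatrix (Function.update S b k) id).det = (W * D⁻¹) k b := by
    rw [h1, ← Matrix.det_transpose, ← Matrix.updateCol_transpose, ← Matrix.cramer_apply,
      Matrix.transpose_one, Matrix.cramer_one]
    rfl
  rw [← h2, ← hM]
  exact abs_det_submatrix_le_maxMinor _ _

lemma maxMinor_pos_of_leftInverse [Fintype κ] [DecidableEq κ] {C : Matrix κ ι ℝ} {H : Matrix ι κ ℝ}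
    (h : H * C = 1) : 0 < maxMinor C := by
  by_contra h0
  have h0' : maxMinor C = 0 := le_antisymm (not_lt.mp h0) (maxMinor_nonneg C)
  have h1 := maxMinor_mul_left_le H C
    (c := ∑ k, ∑ l, |H k l|)
    (fun k => Finset.single_le_sum (f := fun k => ∑ l, |H k l|)
      (fun k _ => Finset.sum_nonneg fun _ _ => abs_nonneg _) (Finset.mem_univ k))
    (Finset.sum_nonneg fun _ _ => Finset.sum_nonneg fun _ _ => abs_nonneg _)
  rw [h, h0', mul_zero] at h1
  have h2 := abs_det_submatrix_le_maxMinor (1 : Matrix ι ι ℝ) id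
  simp at h2
  linarith

lemma maxMinor_pos_of_injective [Fintype κ] [DecidableEq κ] {C : Matrix κ ι ℝ}
    (h : ∀ x : ι → ℝ, C.mulVec x = 0 → x = 0) : 0 < maxMinor C := by
  obtain ⟨g, hg⟩ := LinearMap.exists_leftInverse_of_injective (Matrix.toLin' C)
    (LinearMap.ker_eq_bot'.mpr fun x hx => h x (by simpa using hx))
  refine maxMinor_pos_of_leftInverse (H := LinearMap.toMatrix' g) ?_
  have : LinearMap.toMatrix' (g.comp (Matrix.toLin' C)) = 1 := by
    rw [hg, LinearMap.toMatrix'_id]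
  rwa [LinearMap.toMatrix'_comp, LinearMap.toMatrix'_toLin'] at this

lemma maxMinor_eq_zero_of_mulVec {C : Matrix κ ι ℝ} {x : ι → ℝ} (hx : x ≠ 0)
    (h : C.mulVec x = 0) : maxMinor C = 0 := by
  refine le_antisymm (maxMinor_le le_rfl fun S => ?_) (maxMinor_nonneg C)
  have : (C.submatrix S id).det = 0 := by
    refine Matrix.exists_mulVec_eq_zero_iff.mp ⟨x, hx, ?_⟩
    ext a
    exact congrFun h (S a)
  simp [this]

variable {γ : Type*} [Fintype γ] [DecidableEq γ]

lemma maxMinor_fromCols_le [Fintype κ] [DecidableEq κ] [Nonempty κ] {A : Matrix κ ι ℝ}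
    (C : Matrix κ γ ℝ) (hA : 0 < maxMinor A) :
    maxMinor (Matrix.fromCols A C)
      ≤ (Fintype.card ι + Fintype.card γ).factorial * (maxMinor A * maxMinor C) := by
  rcases (maxMinor_nonneg C).eq_or_lt with h0 | hC
  · have : ∃ x : γ → ℝ, C.mulVec x = 0 ∧ x ≠ 0 := by
      by_contra hcon
      push Not at hcon
      exact (maxMinor_pos_of_injective hcon).ne h0
    obtain ⟨x, hx, hx0⟩ := this
    rw [maxMinor_eq_zero_of_mulVec (x := Sum.elim 0 x), ← h0]
    · simp
    · intro h
      exact hx0 (funext fun c => congrFun h (Sum.inr c))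
    · rw [Matrix.fromCols_mulVec]
      simp [hx]
  · obtain ⟨S, Z, hS, hAZ, -, hZ⟩ := exists_normalForm hA
    obtain ⟨T, Y, hT, hCY, -, hY⟩ := exists_normalForm hC
    have h1 : Matrix.fromCols A C = Matrix.fromCols Z Y *
        Matrix.fromBlocks (A.submatrix S id) 0 0 (C.submatrix T id) := by
      rw [Matrix.fromCols_mul_fromBlocks]
      simp [← hAZ, ← hCY]
    rw [h1, maxMinor_mul_right, Matrix.det_fromBlocks_zero₁₂, abs_mul, hS, hT]
    refine mul_le_mul_of_nonneg_right ?_ (mul_pos hA hC).le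
    refine maxMinor_le (by positivity) fun U => ?_
    have := Matrix.det_le (A := (Matrix.fromCols Z Y).submatrix U id)
      (abv := AbsoluteValue.abs) (x := (1 : ℝ)) (by
        rintro i (j | j)
        · exact hZ _ _
        · exact hY _ _)
    simpa using this

/-- Submodularity of covolumes, up to a constant: if the columns of `E` lie in the span of those
of `W`, then `|E| |W + F| ≤ k! |W| |E + F|`. -/
lemma maxMinor_submodular {β : Type*} [Fintype β] [DecidableEq β] [Fintype κ] [DecidableEq κ]
    [Nonempty κ] {E : Matrix κ ι ℝ} {W : Matrix κ β ℝ} (F : Matrix κ γ ℝ)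
    (hE : 0 < maxMinor E) (hW : 0 < maxMinor W) {G : Matrix β ι ℝ} (hG : E = W * G) :
    maxMinor E * maxMinor (Matrix.fromCols W F) ≤
      (Fintype.card β + Fintype.card γ).factorial *
        (maxMinor W * maxMinor (Matrix.fromCols E F)) := by
  obtain ⟨S, Z, hS, hEZ, hZS, -⟩ := exists_normalForm hE
  set D := E.submatrix S id with hD
  have hdet : IsUnit D.det := by
    refine isUnit_iff_ne_zero.mpr fun h => ?_
    rw [h, abs_zero] at hS
    exact hE.ne hS
  have hZE : Z = E * D⁻¹ := by
    conv_rhs => rw [hEZ]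
    rw [Matrix.mul_assoc, Matrix.mul_nonsing_inv D hdet, Matrix.mul_one]
  -- `F'` is `F` modulo the span of `E`, chosen to vanish on the rows `S`.
  set F' := F - Z * F.submatrix S id with hF'
  have hF'S : F'.submatrix S id = 0 := by
    have : F'.submatrix S id = F.submatrix S id - Z.submatrix S id * F.submatrix S id := rfl
    rw [this, hZS, Matrix.one_mul, sub_self]
  have hWF : maxMinor (Matrix.fromCols W F) = maxMinor (Matrix.fromCols W F') := by
    have : Matrix.fromCols W F' = Matrix.fromCols W F *
        Matrix.fromBlocks (1 : Matrix β β ℝ) (-(G * D⁻¹ * F.submatrix S id)) 0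
          (1 : Matrix γ γ ℝ) := by
      rw [Matrix.fromCols_mul_fromBlocks]
      simp only [Matrix.mul_one, Matrix.mul_zero, add_zero, Matrix.mul_neg]
      rw [hF', hZE, hG]
      congr 1
      simp only [Matrix.mul_assoc]
      abel
    rw [this, maxMinor_mul_right, Matrix.det_fromBlocks_zero₂₁]
    simp
  have hEF : maxMinor (Matrix.fromCols E F) = maxMinor (Matrix.fromCols E F') := by
    have : Matrix.fromCols E F' = Matrix.fromCols E F *
        Matrix.fromBlocks (1 : Matrix ι ι ℝ) (-(D⁻¹ * F.submatrix S id)) 0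
          (1 : Matrix γ γ ℝ) := by
      rw [Matrix.fromCols_mul_fromBlocks]
      simp only [Matrix.mul_one, Matrix.mul_zero, add_zero, Matrix.mul_neg]
      rw [hF', hZE]
      congr 1
      simp only [Matrix.mul_assoc]
      abel
    rw [this, maxMinor_mul_right, Matrix.det_fromBlocks_zero₂₁]
    simp
  have hlow : maxMinor E * maxMinor F' ≤ maxMinor (Matrix.fromCols E F) := by
    obtain ⟨T, hT⟩ := exists_abs_det_eq_maxMinor F'
    have h1 := abs_det_submatrix_le_maxMinor (Matrix.fromCols E F') (Sum.elim S T)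
    have h2 : (Matrix.fromCols E F').submatrix (Sum.elim S T) id
        = Matrix.fromBlocks D 0 (E.submatrix T id) (F'.submatrix T id) := by
      rw [← hF'S]
      ext (a | a) (b | b) <;> rfl
    rw [h2, Matrix.det_fromBlocks_zero₁₂, abs_mul, hS, hT] at h1
    rwa [hEF]
  calc maxMinor E * maxMinor (Matrix.fromCols W F)
      ≤ maxMinor E * ((Fintype.card β + Fintype.card γ).factorial *
          (maxMinor W * maxMinor F')) := by
        rw [hWF]
        exact mul_le_mul_of_nonneg_left (maxMinor_fromCols_le F' hW) hE.le
    _ = (Fintype.card β + Fintype.card γ).factorial *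
          (maxMinor W * (maxMinor E * maxMinor F')) := by ring
    _ ≤ _ := by gcongr

end MaxMinor

/-! ### Sublevel sets of multi-affine functions -/

section Sublevel

lemma card_le_of_pairwise_lt {L : ℕ} (A : Finset (Fin L)) {x : ℝ} (hx : 0 ≤ x)
    (h : ∀ s ∈ A, ∀ t ∈ A, ((t : ℕ) : ℝ) - ((s : ℕ) : ℝ) ≤ x) : (A.card : ℝ) ≤ x + 1 := by
  rcases A.eq_empty_or_nonempty with rfl | hA
  · simp; linarith
  have hsub : A ⊆ Finset.Icc (A.min' hA) (A.max' hA) := fun t ht =>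
    Finset.mem_Icc.mpr ⟨A.min'_le t ht, A.le_max' t ht⟩
  have h1 := Finset.card_le_card hsub
  rw [Fin.card_Icc] at h1
  have h2 := h _ (A.min'_mem hA) _ (A.max'_mem hA)
  have h3 : ((A.min' hA : Fin L) : ℕ) ≤ (A.max' hA : Fin L) := A.min'_le _ (A.max'_mem hA)
  have h4 : (A.card : ℝ) ≤ (((A.max' hA : Fin L) : ℕ) + 1 - ((A.min' hA : Fin L) : ℕ) : ℕ) := by
    exact_mod_cast h1
  rw [Nat.cast_sub (by omega)] at h4
  push_cast at h4
  linarith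

/-- An affine function that is large at one point of `[-V, V]` is small on few points of
`{0, 1/L, …, (L-1)/L}`. -/
lemma card_affine_small_le {L : ℕ} (hL : 0 < L) {A B v V η Λ : ℝ} (hv : |v| ≤ V) (hη : 0 ≤ η)
    (hη' : η ≤ 1 / 2) (hΛ : 0 < Λ) (hAB : Λ ≤ |A + B * v|) :
    ((Finset.univ.filter fun t : Fin L => |A + B * ((t : ℕ) / L : ℝ)| < η * Λ).card : ℝ)
      ≤ 4 * η * (V + 1) * L + 1 := by
  have hL' : (0 : ℝ) < L := by exact_mod_cast hL
  have hV : 0 ≤ V := (abs_nonneg v).trans hv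
  refine card_le_of_pairwise_lt _ (by positivity) fun s hs t ht => ?_
  rw [Finset.mem_filter] at hs ht
  have hs01 : |v - (s : ℕ) / L| ≤ V + 1 := by
    have h1 : (((s : ℕ) : ℝ)) / L ≤ 1 := by
      rw [div_le_one hL']
      exact_mod_cast s.2.le
    have h2 : 0 ≤ (((s : ℕ) : ℝ)) / L := by positivity
    rw [abs_le] at hv ⊢
    constructor <;> linarith
  have hB : Λ / 2 ≤ |B| * (V + 1) := by
    have h1 : A + B * v = (A + B * ((s : ℕ) / L : ℝ)) + B * (v - (s : ℕ) / L) := by ring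
    have h2 := abs_add_le (A + B * ((s : ℕ) / L : ℝ)) (B * (v - (s : ℕ) / L))
    rw [← h1, abs_mul B] at h2
    have h3 := mul_le_mul_of_nonneg_left hs01 (abs_nonneg B)
    have h4 : η * Λ ≤ 1 / 2 * Λ := mul_le_mul_of_nonneg_right hη' hΛ.le
    linarith [hs.2]
  by_contra hcon
  push Not at hcon
  have h5 : |B| * ((((t : ℕ) : ℝ) - ((s : ℕ) : ℝ)) / L) ≤ 2 * (η * Λ) := by
    have h6 : |B * (((((t : ℕ) : ℝ)) - ((s : ℕ) : ℝ)) / L)| ≤ 2 * (η * Λ) := by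
      have : B * ((((t : ℕ) : ℝ) - ((s : ℕ) : ℝ)) / L) =
        (A + B * ((t : ℕ) / L : ℝ)) - (A + B * ((s : ℕ) / L : ℝ)) := by ring
      rw [this]
      refine (abs_sub _ _).trans ?_
      linarith [hs.2, ht.2]
    refine le_trans ?_ h6
    rw [abs_mul]
    exact mul_le_mul_of_nonneg_left (le_abs_self _) (abs_nonneg B)
  have h7 : 4 * η * (V + 1) < (((t : ℕ) : ℝ) - ((s : ℕ) : ℝ)) / L := by
    rw [lt_div_iff₀ hL']
    exact hcon
  have hBpos : 0 < |B| := by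
    by_contra h
    have : |B| = 0 := le_antisymm (not_lt.mp h) (abs_nonneg B)
    rw [this, zero_mul] at hB
    linarith
  have h8 : |B| * (4 * η * (V + 1)) < 2 * (η * Λ) :=
    (mul_lt_mul_of_pos_left h7 hBpos).trans_le h5
  have h9 : 4 * η * (Λ / 2) ≤ 4 * η * (|B| * (V + 1)) :=
    mul_le_mul_of_nonneg_left hB (by positivity)
  linarith [h8, h9]

variable {ι : Type*} [Fintype ι] [DecidableEq ι]

/-- Fubini's theorem for counting: a set that meets each line in direction `a` in at most `c` points
has at most `c` points for each such line. -/
lemma card_mul_le_of_fiber_le {α : Type*} [Fintype α] [DecidableEq α] (a : ι)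
    (bad : Finset (ι → α)) {c : ℝ}
    (h : ∀ x : ι → α, ((Finset.univ.filter fun t => Function.update x a t ∈ bad).card : ℝ) ≤ c) :
    (bad.card : ℝ) * Fintype.card α ≤ c * (Fintype.card α : ℝ) ^ Fintype.card ι := by
  -- `(x, t) ↦ (update x a t, x a)` is an involution
  let φ : (ι → α) × α → (ι → α) × α := fun p => (Function.update p.1 a p.2, p.1 a)
  have hφ : Function.Involutive φ := by
    rintro ⟨x, t⟩
    simp [φ]
  have h1 : ((bad ×ˢ (Finset.univ : Finset α)).card : ℝ)
      = ∑ x : ι → α, ((Finset.univ.filter fun t => Function.update x a t ∈ bad).card : ℝ) := by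
    rw [← Nat.cast_sum, ← Finset.card_sigma]
    congr 1
    refine Finset.card_bij' (fun p _ => ⟨(φ p).1, (φ p).2⟩) (fun p _ => φ (p.1, p.2)) ?_ ?_ ?_ ?_
    · intro p hp
      simp only [Finset.mem_product, Finset.mem_univ, and_true] at hp
      simpa [φ] using hp
    · rintro ⟨x, t⟩ hp
      simpa [φ] using hp
    · intro p _
      exact hφ p
    · rintro ⟨x, t⟩ _
      have := hφ (x, t)
      simp only [this]
  rw [Finset.card_product, Nat.cast_mul, Finset.card_univ] at h1
  rw [h1]
  refine (Finset.sum_le_sum fun x _ => h x).trans ?_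
  simp [mul_comm]

/-- A function which is affine in each variable and not small at one point of `[-V, V]^ι`
is small at few points of the grid `{0, 1/L, …, (L-1)/L}^ι`. -/
lemma card_multiaffine_small_le {L : ℕ} (hL : 0 < L) (f : (ι → ℝ) → ℝ)
    (hf : ∀ x a, ∃ A B : ℝ, ∀ s, f (Function.update x a s) = A + B * s)
    {v : ι → ℝ} {V η : ℝ} (hv : ∀ a, |v a| ≤ V) (hη : 0 < η) (hη' : η ≤ 1 / 2) (hfv : f v ≠ 0) :
    ((Finset.univ.filter fun h : ι → Fin L =>
        |f (fun a => ((h a : ℕ) / L : ℝ))| < η ^ Fintype.card ι * |f v|).card : ℝ) * L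
      ≤ Fintype.card ι * (4 * η * (V + 1) * L + 1) * (L : ℝ) ^ Fintype.card ι := by
  -- switch the coordinates from `v` to the grid point one after the other
  let mix : Finset ι → (ι → Fin L) → ι → ℝ := fun s h a => if a ∈ s then ((h a : ℕ) / L : ℝ) else v a
  let bad : Finset ι → Finset (ι → Fin L) := fun s =>
    Finset.univ.filter fun h => |f (mix s h)| < η ^ s.card * |f v|
  have key : ∀ s : Finset ι, ((bad s).card : ℝ) * L
      ≤ s.card * (4 * η * (V + 1) * L + 1) * (L : ℝ) ^ Fintype.card ι := by
    intro s
    induction s using Finset.induction_on with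
    | empty =>
      have : bad ∅ = ∅ := by
        refine Finset.filter_eq_empty_iff.mpr fun h _ => ?_
        simp [mix]
      simp [this]
    | insert a s ha ih =>
      let new : Finset (ι → Fin L) := Finset.univ.filter fun h =>
        η ^ s.card * |f v| ≤ |f (mix s h)| ∧ |f (mix (insert a s) h)| < η * (η ^ s.card * |f v|)
      have hsub : bad (insert a s) ⊆ bad s ∪ new := by
        intro h hh
        simp only [bad, new, Finset.mem_union, Finset.mem_filter, Finset.mem_univ, true_and] at hh ⊢
        rw [Finset.card_insert_of_notMem ha, pow_succ'] at hh
        by_cases h1 : |f (mix s h)| < η ^ s.card * |f v|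
        · exact Or.inl h1
        · exact Or.inr ⟨not_lt.mp h1, by linarith⟩
      have hnew : (new.card : ℝ) * L
          ≤ (4 * η * (V + 1) * L + 1) * (L : ℝ) ^ Fintype.card ι := by
        have := card_mul_le_of_fiber_le a new (c := 4 * η * (V + 1) * L + 1) (fun x => ?_)
        · simpa using this
        obtain ⟨A, B, hAB⟩ := hf (mix s x) a
        have hmix1 : ∀ t, mix s (Function.update x a t) = Function.update (mix s x) a (v a) := by
          intro t
          ext b
          by_cases hb : b = a
          · subst hb
            simp [mix, ha]
          · simp [mix, hb]
        have hmix2 : ∀ t, mix (insert a s) (Function.update x a t)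
            = Function.update (mix s x) a ((t : ℕ) / L : ℝ) := by
          intro t
          ext b
          by_cases hb : b = a
          · subst hb
            simp [mix]
          · simp [mix, hb]
        have hΛ : 0 < η ^ s.card * |f v| := by positivity
        by_cases hbig : η ^ s.card * |f v| ≤ |A + B * v a|
        · refine le_trans ?_ (card_affine_small_le hL (hv a) hη.le hη' hΛ hbig)
          have := Finset.card_le_card (s := Finset.univ.filter fun t => Function.update x a t ∈ new)
            (t := Finset.univ.filter fun t : Fin L =>
              |A + B * ((t : ℕ) / L : ℝ)| < η * (η ^ s.card * |f v|)) (by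
              intro t ht
              simp only [new, Finset.mem_filter, Finset.mem_univ, true_and] at ht ⊢
              rw [← hAB, ← hmix2]
              exact ht.2)
          exact_mod_cast this
        · have : (Finset.univ.filter fun t => Function.update x a t ∈ new) = ∅ := by
            refine Finset.filter_eq_empty_iff.mpr fun t _ ht => hbig ?_
            simp only [new, Finset.mem_filter, Finset.mem_univ, true_and] at ht
            rw [← hAB, ← hmix1 t]
            exact ht.1
          rw [this]
          have hV : 0 ≤ V := (abs_nonneg _).trans (hv a)
          simp only [Finset.card_empty, Nat.cast_zero]
          positivity
      have h1 : ((bad (insert a s)).card : ℝ) ≤ (bad s).card + new.card := by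
        exact_mod_cast (Finset.card_le_card hsub).trans (Finset.card_union_le _ _)
      rw [Finset.card_insert_of_notMem ha]
      push_cast
      nlinarith [mul_le_mul_of_nonneg_right h1 (Nat.cast_nonneg (α := ℝ) L)]
  have h := key Finset.univ
  simpa only [bad, mix, Finset.mem_univ, if_true, Finset.card_univ] using h

end Sublevel

/-! ### Renormalization steps and the growth of covolumes -/

section Shear

variable {κ μ : Type*}

/-- The weights of the diagonal flow, expanding `ℝ^κ` and contracting `ℝ^μ`. -/
noncomputable def flowWeight (κ μ : Type*) [Fintype κ] [Fintype μ] (R : ℝ) : κ ⊕ μ → ℝ :=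
  Sum.elim (fun _ => R ^ Fintype.card μ) (fun _ => (R ^ Fintype.card κ)⁻¹)

lemma prod_flowWeight [Fintype κ] [Fintype μ] {R : ℝ} (hR : 0 < R) : ∏ k, flowWeight κ μ R k = 1 := by
  simp only [Fintype.prod_sum_type, flowWeight, Sum.elim_inl, Sum.elim_inr, Finset.prod_const,
    Finset.card_univ]
  rw [← pow_mul, inv_pow, ← pow_mul, mul_comm (Fintype.card κ)]
  exact mul_inv_cancel₀ (pow_pos hR _).ne'

variable [DecidableEq κ] [DecidableEq μ]

/-- The unipotent matrix `(y, q) ↦ (y + q h, q)` of `ℝ^κ × ℝ^μ`. -/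
def shear (h : μ → κ → ℝ) : Matrix (κ ⊕ μ) (κ ⊕ μ) ℝ :=
  Matrix.fromBlocks 1 (Matrix.of h).transpose 0 1

lemma shear_zero : shear (0 : μ → κ → ℝ) = 1 := by
  unfold shear
  have : (Matrix.of (0 : μ → κ → ℝ)).transpose = 0 := rfl
  rw [this, Matrix.fromBlocks_one]

variable [Fintype κ] [Fintype μ]

/-- One step of the renormalization: a shear followed by the diagonal flow. -/
noncomputable def renorm (R : ℝ) (h : μ → κ → ℝ) : Matrix (κ ⊕ μ) (κ ⊕ μ) ℝ :=
  Matrix.diagonal (flowWeight κ μ R) * shear h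

lemma shear_mul_shear (v w : μ → κ → ℝ) : shear v * shear w = shear (v + w) := by
  unfold shear
  rw [Matrix.fromBlocks_multiply]
  congr 1
  · simp
  · ext i j
    simp [add_comm]
  · simp
  · simp

lemma det_shear (h : μ → κ → ℝ) : (shear h).det = 1 := by
  simp [shear]

lemma det_renorm {R : ℝ} (hR : 0 < R) (h : μ → κ → ℝ) : (renorm R h).det = 1 := by
  rw [renorm, Matrix.det_mul, det_shear, Matrix.det_diagonal, prod_flowWeight hR, mul_one]

variable {ι : Type*}

lemma shear_single_mul_apply_self (i : μ) (j : κ) (s : ℝ) (W : Matrix (κ ⊕ μ) ι ℝ) :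
    (shear (Pi.single i (Pi.single j s)) * W) (Sum.inl j)
      = W (Sum.inl j) + s • W (Sum.inr i) := by
  ext b
  simp [shear, Matrix.mul_apply, Fintype.sum_sum_type, Matrix.one_apply, Pi.single_apply]
  rw [Finset.sum_eq_single i]
  · simp
  · intro c _ hc
    simp [hc]
  · simp

lemma shear_single_mul_apply_of_ne (i : μ) (j : κ) (s : ℝ) (W : Matrix (κ ⊕ μ) ι ℝ) {k : κ ⊕ μ}
    (hk : k ≠ Sum.inl j) : (shear (Pi.single i (Pi.single j s)) * W) k = W k := by
  ext b
  rcases k with j' | i'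
  · have hj : j' ≠ j := fun h => hk (by rw [h])
    simp [shear, Matrix.mul_apply, Fintype.sum_sum_type, Matrix.one_apply, Pi.single_apply]
    refine Finset.sum_eq_zero fun c _ => ?_
    by_cases hc : c = i
    · subst hc
      simp [hj]
    · simp [hc]
  · simp [shear, Matrix.mul_apply, Fintype.sum_sum_type, Matrix.one_apply]

variable [Fintype ι]

/-- Rows on which the diagonal flow expands the most: all of them in `ℝ^κ`, or else
exhausting `ℝ^κ`. -/
def IsTopRows (T : ι → κ ⊕ μ) : Prop :=
  (∀ a, (T a).isLeft) ∨ ∀ j : κ, ∃ a, T a = Sum.inl j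

lemma le_prod_flowWeight [Nonempty κ] [Nonempty μ] {R : ℝ} (hR : 1 ≤ R) {T : ι → κ ⊕ μ}
    (hinj : Function.Injective T) (hT : IsTopRows T) (h0 : 0 < Fintype.card ι)
    (h1 : Fintype.card ι < Fintype.card κ + Fintype.card μ) :
    R ≤ ∏ a, flowWeight κ μ R (T a) := by
  have hR0 : 0 < R := one_pos.trans_le hR
  rcases hT with hT | hT
  · have : ∀ a, flowWeight κ μ R (T a) = R ^ Fintype.card μ := by
      intro a
      obtain ⟨j, hj⟩ := Sum.isLeft_iff.mp (hT a)
      rw [hj]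
      rfl
    simp only [this, Finset.prod_const, Finset.card_univ]
    rw [← pow_mul]
    exact le_self_pow₀ hR (Nat.mul_ne_zero Fintype.card_ne_zero h0.ne')
  · have h2 := Finset.prod_mul_prod_compl (Finset.univ.image T) (flowWeight κ μ R)
    rw [prod_flowWeight hR0, Finset.prod_image (fun a _ b _ h => hinj h)] at h2
    have h3 : ∏ k ∈ (Finset.univ.image T)ᶜ, flowWeight κ μ R k
        = (R ^ (Fintype.card κ * ((Finset.univ.image T)ᶜ).card))⁻¹ := by
      rw [pow_mul, ← inv_pow, ← Finset.prod_const]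
      refine Finset.prod_congr rfl fun k hk => ?_
      rcases k with j | i
      · obtain ⟨a, ha⟩ := hT j
        simp only [Finset.mem_compl, Finset.mem_image, Finset.mem_univ, true_and, not_exists] at hk
        exact absurd ha (hk a)
      · rfl
    have hcard : ((Finset.univ.image T)ᶜ).card ≠ 0 := by
      rw [Finset.card_compl, Finset.card_image_of_injective _ hinj, Finset.card_univ,
        Fintype.card_sum]
      omega
    rw [h3] at h2
    have h4 : ∏ a, flowWeight κ μ R (T a)
        = R ^ (Fintype.card κ * ((Finset.univ.image T)ᶜ).card) :=
      (mul_inv_eq_one₀ (pow_pos hR0 _).ne').mp h2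
    rw [h4]
    exact le_self_pow₀ hR (Nat.mul_ne_zero Fintype.card_ne_zero hcard)

variable [DecidableEq ι]

/-- Every minor is bounded by a minor with top rows, after a suitable bounded shear:
the rows in `ℝ^μ` are exchanged for rows in `ℝ^κ` one after the other. -/
lemma exists_isTopRows_minor (k : ℕ) : ∀ (S : ι → κ ⊕ μ) (W : Matrix (κ ⊕ μ) ι ℝ),
    Function.Injective S → (Finset.univ.filter fun a => (S a).isRight).card ≤ k →
    ∃ (T : ι → κ ⊕ μ) (v : μ → κ → ℝ), Function.Injective T ∧ IsTopRows T ∧ (∀ i j, |v i j| ≤ k) ∧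
      |(W.submatrix S id).det| ≤ 2 ^ k * |((shear v * W).submatrix T id).det| := by
  induction k with
  | zero =>
    intro S W hS hk
    refine ⟨S, 0, hS, Or.inl fun a => ?_, by simp, by simp [shear_zero]⟩
    have h := Finset.filter_eq_empty_iff.mp (Finset.card_eq_zero.mp (Nat.le_zero.mp hk))
      (Finset.mem_univ a)
    simpa using h
  | succ k ih =>
    intro S W hS hk
    by_cases htop : IsTopRows S
    · refine ⟨S, 0, hS, htop, fun i j => by simp; positivity, ?_⟩
      rw [shear_zero, Matrix.one_mul]
      exact le_mul_of_one_le_left (abs_nonneg _) (one_le_pow₀ one_le_two)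
    obtain ⟨⟨a, ha⟩, j, hj⟩ : (∃ a, ¬ (S a).isLeft) ∧ ∃ j : κ, ∀ a, S a ≠ Sum.inl j := by
      simpa [IsTopRows] using htop
    obtain ⟨i, hi⟩ : ∃ i, S a = Sum.inr i := Sum.isRight_iff.mp (by simpa using ha)
    set S' := Function.update S a (Sum.inl j) with hS'
    have hS'inj : Function.Injective S' := by
      intro b c hbc
      by_cases hb : b = a <;> by_cases hc : c = a
      · rw [hb, hc]
      · subst hb
        rw [hS', Function.update_self, Function.update_of_ne hc] at hbc
        exact absurd hbc.symm (hj c)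
      · subst hc
        rw [hS', Function.update_self, Function.update_of_ne hb] at hbc
        exact absurd hbc (hj b)
      · rw [hS', Function.update_of_ne hb, Function.update_of_ne hc] at hbc
        exact hS hbc
    have hcard : (Finset.univ.filter fun b => (S' b).isRight).card ≤ k := by
      refine Nat.le_of_lt_succ (lt_of_lt_of_le (Finset.card_lt_card ?_) hk)
      refine (Finset.ssubset_iff_of_subset ?_).mpr ⟨a, ?_, ?_⟩
      · intro b hb
        simp only [Finset.mem_filter, Finset.mem_univ, true_and] at hb ⊢
        by_cases hba : b = a
        · subst hba
          simp [hi]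
        · rwa [hS', Function.update_of_ne hba] at hb
      · simp [hi]
      · simp [hS']
    have hdet : ∀ s : ℝ, ((shear (Pi.single i (Pi.single j s)) * W).submatrix S' id).det
        = ((W.submatrix S id).updateRow a (W (Sum.inl j))).det + s * (W.submatrix S id).det := by
      intro s
      have h1 : (shear (Pi.single i (Pi.single j s)) * W).submatrix S' id
          = (W.submatrix S id).updateRow a (W (Sum.inl j) + s • W (Sum.inr i)) := by
        funext b
        by_cases hba : b = a
        · subst hba
          rw [Matrix.updateRow_self, ← shear_single_mul_apply_self]
          funext c
          simp [hS']
        · rw [Matrix.updateRow_ne hba]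
          have : S' b ≠ Sum.inl j := by
            rw [hS', Function.update_of_ne hba]
            exact hj b
          have h2 := shear_single_mul_apply_of_ne i j s W this
          have h3 : S' b = S b := by rw [hS', Function.update_of_ne hba]
          funext c
          have := congrFun h2 c
          simpa [h3] using this
      have h2 : (W.submatrix S id).updateRow a (W (Sum.inr i)) = W.submatrix S id := by
        have : W (Sum.inr i) = (W.submatrix S id) a := by
          funext c
          simp [hi]
        rw [this, Matrix.updateRow_eq_self]
      rw [h1, Matrix.det_updateRow_add, Matrix.det_updateRow_smul, h2]
    obtain ⟨s, hs, hs1⟩ : ∃ s : ℝ, |s| ≤ 1 ∧ |(W.submatrix S id).det| ≤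
        2 * |((shear (Pi.single i (Pi.single j s)) * W).submatrix S' id).det| := by
      by_contra hcon
      push Not at hcon
      have e0 := hcon 0 (by simp)
      have e1 := hcon 1 (by simp)
      rw [hdet] at e0 e1
      set x := ((W.submatrix S id).updateRow a (W (Sum.inl j))).det
      set y := (W.submatrix S id).det
      have : |y| ≤ |x + 1 * y| + |x + 0 * y| := by
        have h := abs_sub (x + 1 * y) (x + 0 * y)
        have e : x + 1 * y - (x + 0 * y) = y := by ring
        rwa [e] at h
      linarith
    obtain ⟨T, v, hTinj, hTtop, hv, hdetv⟩ :=
      ih S' (shear (Pi.single i (Pi.single j s)) * W) hS'inj hcard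
    refine ⟨T, v + Pi.single i (Pi.single j s), hTinj, hTtop, fun i' j' => ?_, ?_⟩
    · have h1 : |(Pi.single i (Pi.single j s) : μ → κ → ℝ) i' j'| ≤ 1 := by
        by_cases hi' : i' = i
        · subst hi'
          rw [Pi.single_eq_same]
          by_cases hj' : j' = j
          · subst hj'
            rwa [Pi.single_eq_same]
          · rw [Pi.single_eq_of_ne hj']
            simp
        · rw [Pi.single_eq_of_ne hi']
          simp
      push_cast
      exact (abs_add_le _ _).trans (add_le_add (hv i' j') h1)
    · rw [← Matrix.mul_assoc, shear_mul_shear] at hdetv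
      rw [pow_succ]
      linarith

/-- The minors of a sheared matrix are multi-affine in the entries of the shear: each entry affects
one row only. -/
lemma minor_shear_affine (W : Matrix (κ ⊕ μ) ι ℝ) {T : ι → κ ⊕ μ} (hT : Function.Injective T)
    (x : μ × κ → ℝ) (p : μ × κ) : ∃ A B : ℝ, ∀ s : ℝ,
      ((shear (Function.curry (Function.update x p s)) * W).submatrix T id).det = A + B * s := by
  obtain ⟨i, j⟩ := p
  set W₀ := shear (Function.curry (Function.update x (i, j) 0)) * W with hW₀
  have hsplit : ∀ s, shear (Function.curry (Function.update x (i, j) s)) * W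
      = shear (Pi.single i (Pi.single j s)) * W₀ := by
    intro s
    rw [hW₀, ← Matrix.mul_assoc, shear_mul_shear]
    congr 2
    ext i' j'
    by_cases hi : i' = i
    · subst hi
      by_cases hj : j' = j
      · subst hj
        simp [Function.curry]
      · simp [Function.curry, hj]
    · simp [Function.curry, hi]
  by_cases hex : ∃ a, T a = Sum.inl j
  · obtain ⟨a, ha⟩ := hex
    refine ⟨((W₀.submatrix T id).updateRow a (W₀ (Sum.inl j))).det,
      ((W₀.submatrix T id).updateRow a (W₀ (Sum.inr i))).det, fun s => ?_⟩
    have h1 : (shear (Pi.single i (Pi.single j s)) * W₀).submatrix T id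
        = (W₀.submatrix T id).updateRow a (W₀ (Sum.inl j) + s • W₀ (Sum.inr i)) := by
      funext b
      by_cases hba : b = a
      · subst hba
        rw [Matrix.updateRow_self, ← shear_single_mul_apply_self]
        funext c
        simp [ha]
      · rw [Matrix.updateRow_ne hba]
        have : T b ≠ Sum.inl j := fun h => hba (hT (h.trans ha.symm))
        funext c
        exact congrFun (shear_single_mul_apply_of_ne i j s W₀ this) c
    rw [hsplit, h1, Matrix.det_updateRow_add, Matrix.det_updateRow_smul]
    ring
  · push Not at hex
    refine ⟨(W₀.submatrix T id).det, 0, fun s => ?_⟩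
    rw [hsplit]
    have : (shear (Pi.single i (Pi.single j s)) * W₀).submatrix T id = W₀.submatrix T id := by
      funext b c
      exact congrFun (shear_single_mul_apply_of_ne i j s W₀ (hex b)) c
    rw [this]
    ring

lemma det_submatrix_renorm_mul (R : ℝ) (h : μ → κ → ℝ) (W : Matrix (κ ⊕ μ) ι ℝ)
    (T : ι → κ ⊕ μ) : ((renorm R h * W).submatrix T id).det
      = (∏ a, flowWeight κ μ R (T a)) * ((shear h * W).submatrix T id).det := by
  have : (renorm R h * W).submatrix T id
      = Matrix.diagonal (fun a => flowWeight κ μ R (T a)) * (shear h * W).submatrix T id := by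
    rw [renorm, Matrix.mul_assoc]
    ext a b
    simp [Matrix.diagonal_mul]
  rw [this, Matrix.det_mul, Matrix.det_diagonal]

/-- The matrix of real numbers `t / L` attached to a matrix of digits `t`. -/
noncomputable def digitShift {L : ℕ} (t : μ × κ → Fin L) : μ → κ → ℝ :=
  Function.curry fun p => ((t p : ℕ) / L : ℝ)

/-- A subgroup of intermediate rank is shrunk by few of the renormalization steps. -/
lemma card_shrinking_le [Nonempty κ] [Nonempty μ] {R η : ℝ} (hR : 1 ≤ R) (hη : 0 < η)
    (hη' : η ≤ 1 / 2) {L : ℕ} (hL : 0 < L) (W : Matrix (κ ⊕ μ) ι ℝ) (hW : 0 < maxMinor W)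
    (h0 : 0 < Fintype.card ι) (h1 : Fintype.card ι < Fintype.card κ + Fintype.card μ)
    (hRη : 2 ^ Fintype.card ι ≤ R * η ^ Fintype.card (μ × κ)) :
    ((Finset.univ.filter fun t : μ × κ → Fin L =>
        maxMinor (renorm R (digitShift t) * W) < maxMinor W).card : ℝ) * L
      ≤ Fintype.card (μ × κ) * (4 * η * (Fintype.card ι + 1) * L + 1)
        * (L : ℝ) ^ Fintype.card (μ × κ) := by
  obtain ⟨S, hS⟩ := exists_abs_det_eq_maxMinor W
  have hSinj : Function.Injective S := by
    by_contra hcon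
    rw [Function.Injective] at hcon
    push Not at hcon
    obtain ⟨a, b, hab, hne⟩ := hcon
    have : (W.submatrix S id).det = 0 :=
      Matrix.det_zero_of_row_eq hne (by funext c; simp [hab])
    rw [this, abs_zero] at hS
    exact hW.ne hS
  obtain ⟨T, v, hT, htop, hv, hdet⟩ := exists_isTopRows_minor (Fintype.card ι) S W hSinj
    (Finset.card_le_univ _)
  rw [hS] at hdet
  set f : (μ × κ → ℝ) → ℝ := fun x => ((shear (Function.curry x) * W).submatrix T id).det with hf
  have hfv : maxMinor W ≤ 2 ^ Fintype.card ι * |f (Function.uncurry v)| := by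
    simpa [hf] using hdet
  have hfv0 : f (Function.uncurry v) ≠ 0 := by
    intro h
    rw [h] at hfv
    simp at hfv
    linarith
  have hcount := card_multiaffine_small_le hL f (fun x p => minor_shear_affine W hT x p)
    (v := Function.uncurry v) (V := Fintype.card ι) (fun p => hv p.1 p.2) hη hη' hfv0
  refine le_trans (mul_le_mul_of_nonneg_right ?_ (Nat.cast_nonneg L)) hcount
  refine Nat.cast_le.mpr (Finset.card_le_card fun t ht => ?_)
  simp only [Finset.mem_filter, Finset.mem_univ, true_and] at ht ⊢
  by_contra hcon
  push Not at hcon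
  refine absurd ht (not_lt.mpr ?_)
  refine le_trans ?_ (abs_det_submatrix_le_maxMinor _ T)
  rw [det_submatrix_renorm_mul, abs_mul]
  have hp := le_prod_flowWeight hR hT htop h0 h1
  have hR0 : 0 ≤ R := zero_le_one.trans hR
  calc maxMinor W ≤ 2 ^ Fintype.card ι * |f (Function.uncurry v)| := hfv
    _ ≤ R * η ^ Fintype.card (μ × κ) * |f (Function.uncurry v)| :=
        mul_le_mul_of_nonneg_right hRη (abs_nonneg _)
    _ = R * (η ^ Fintype.card (μ × κ) * |f (Function.uncurry v)|) := by ring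
    _ ≤ |∏ a, flowWeight κ μ R (T a)| * |f fun p => ((t p : ℕ) / L : ℝ)| :=
        mul_le_mul (hp.trans (le_abs_self _)) hcon (by positivity) (abs_nonneg _)

end Shear

/-! ### Subgroups of the integer lattice -/

section IntegerColumns

variable {κ ι : Type*} [Fintype ι]

/-- The columns of an integer matrix are linearly independent. -/
def ColIndep (w : Matrix κ ι ℤ) : Prop := ∀ x : ι → ℤ, w.mulVec x = 0 → x = 0

/-- An integer matrix regarded as a real matrix. -/
noncomputable def toRealMat (w : Matrix κ ι ℤ) : Matrix κ ι ℝ := w.map (Int.cast : ℤ → ℝ)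

lemma toRealMat_mul {γ : Type*} (w : Matrix κ ι ℤ) (U : Matrix ι γ ℤ) :
    toRealMat (w * U) = toRealMat w * toRealMat U :=
  Matrix.map_mul (f := Int.castRingHom ℝ)

lemma toRealMat_mulVec (w : Matrix κ ι ℤ) (x : ι → ℤ) :
    (toRealMat w).mulVec (fun b => (x b : ℝ)) = fun k => ((w.mulVec x k : ℤ) : ℝ) := by
  ext k
  simp [toRealMat, Matrix.mulVec, dotProduct]

lemma ColIndep.card_le [Fintype κ] {w : Matrix κ ι ℤ} (hw : ColIndep w) :
    Fintype.card ι ≤ Fintype.card κ := by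
  have := LinearMap.finrank_le_finrank_of_injective (f := w.mulVecLin)
    ((injective_iff_map_eq_zero _).mpr hw)
  simpa using this

/-- A proper saturated subgroup of `ℤ^ι` is spanned by part of a basis. -/
lemma exists_basis_of_saturated (N : Submodule ℤ (ι → ℤ)) (hN : N ≠ ⊤)
    (hsat : ∀ (r : ℤ) (x : ι → ℤ), r ≠ 0 → r • x ∈ N → x ∈ N) :
    ∃ (a j : ℕ) (b : Module.Basis (Fin a ⊕ Fin j) ℤ (ι → ℤ)), 0 < j ∧
      (∀ c, b (Sum.inl c) ∈ N) ∧
      ∀ y : Fin j → ℤ, ∑ c, y c • b (Sum.inr c) ∈ N → y = 0 := by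
  have htf : Module.IsTorsionFree ℤ ((ι → ℤ) ⧸ N) := by
    refine Module.IsTorsionFree.of_smul_eq_zero fun r q hq => ?_
    obtain ⟨x, rfl⟩ := N.mkQ_surjective q
    by_cases hr : r = 0
    · exact Or.inl hr
    · right
      rw [← map_smul] at hq
      rw [Submodule.mkQ_apply, Submodule.Quotient.mk_eq_zero] at hq ⊢
      exact hsat r x hr hq
  have bN := Module.finBasis ℤ N
  have bQ := Module.finBasis ℤ ((ι → ℤ) ⧸ N)
  refine ⟨_, _, bN.sumQuot bQ, ?_, fun c => ?_, fun y hy => ?_⟩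
  · rw [Nat.pos_iff_ne_zero]
    intro h0
    have hemp : IsEmpty (Fin (Module.finrank ℤ ((ι → ℤ) ⧸ N))) := by
      rw [h0]
      infer_instance
    have hsub : Subsingleton ((ι → ℤ) ⧸ N) := bQ.repr.toEquiv.subsingleton
    exact hN (Submodule.Quotient.subsingleton_iff.mp hsub)
  · rw [Module.Basis.sumQuot_inl]
    exact (bN c).2
  · rw [← Submodule.Quotient.mk_eq_zero, ← Submodule.mkQ_apply, map_sum] at hy
    have h2 : ∀ c, N.mkQ (y c • bN.sumQuot bQ (Sum.inr c)) = y c • bQ c := by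
      intro c
      rw [map_smul, Submodule.mkQ_apply, Module.Basis.sumQuot_inr]
    simp only [h2] at hy
    exact funext fun c => Fintype.linearIndependent_iff.mp bQ.linearIndependent y hy c

variable [DecidableEq ι]

/-- A basis of `ℤ^ι` adapted to the vectors `x` for which `w x` lies in a given real subspace. -/
lemma exists_adapted_basis (w : Matrix κ ι ℤ) (V : Submodule ℝ (κ → ℝ))
    (hV : ¬ ∀ b, (toRealMat w).col b ∈ V) :
    ∃ (a j : ℕ) (U : Matrix ι (Fin a ⊕ Fin j) ℤ) (e : ι ≃ Fin a ⊕ Fin j), 0 < j ∧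
      IsUnit (U.submatrix id e).det ∧
      (∀ c, (toRealMat (w * U)).col (Sum.inl c) ∈ V) ∧
      ∀ y : Fin j → ℤ, (fun k => (((w * U).mulVec (Sum.elim 0 y) k : ℤ) : ℝ)) ∈ V → y = 0 := by
  let cast : (κ → ℤ) →ₗ[ℤ] (κ → ℝ) :=
    { toFun := fun v k => (v k : ℝ)
      map_add' := fun v v' => by ext k; simp
      map_smul' := fun c v => by ext k; simp }
  let N : Submodule ℤ (ι → ℤ) := (V.restrictScalars ℤ).comap (cast.comp w.mulVecLin)
  have hN : ∀ x, x ∈ N ↔ (fun k => ((w.mulVec x k : ℤ) : ℝ)) ∈ V := fun x => Iff.rfl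
  have hsat : ∀ (r : ℤ) (x : ι → ℤ), r ≠ 0 → r • x ∈ N → x ∈ N := by
    intro r x hr hq
    rw [hN] at hq ⊢
    have h1 : (fun k => ((w.mulVec (r • x) k : ℤ) : ℝ))
        = (r : ℝ) • fun k => ((w.mulVec x k : ℤ) : ℝ) := by
      rw [Matrix.mulVec_smul]
      ext k
      simp
    rw [h1] at hq
    exact (V.smul_mem_iff (by exact_mod_cast hr)).mp hq
  have hNtop : N ≠ ⊤ := by
    intro htop
    refine hV fun c => ?_
    have h1 : Pi.single c 1 ∈ N := by
      rw [htop]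
      trivial
    rw [hN] at h1
    convert h1 using 1
    ext k
    simp [toRealMat]
  obtain ⟨a, j, b, hj, hbl, hbr⟩ := exists_basis_of_saturated N hNtop hsat
  let e := (Pi.basisFun ℤ ι).indexEquiv b
  let U : Matrix ι (Fin a ⊕ Fin j) ℤ := Matrix.of fun k c => b c k
  have hU : ∀ z, U.mulVec z = ∑ c, z c • b c := by
    intro z
    ext k
    rw [Finset.sum_apply]
    change ∑ c, b c k * z c = ∑ c, z c * b c k
    exact Finset.sum_congr rfl fun c _ => mul_comm _ _
  refine ⟨a, j, U, e, hj, ?_, fun c => ?_, fun y hy => ?_⟩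
  · have h1 := (Pi.basisFun ℤ ι).isUnit_det (b.reindex e.symm)
    rw [Module.Basis.det_apply] at h1
    have h2 : U.submatrix id e = (Pi.basisFun ℤ ι).toMatrix (b.reindex e.symm) := by
      ext k c
      simp [U, Module.Basis.toMatrix_apply]
    rwa [h2]
  · have h1 := hbl c
    rw [hN] at h1
    exact h1
  · rw [← Matrix.mulVec_mulVec, ← hN, hU, Fintype.sum_sum_type] at hy
    simp only [Sum.elim_inl, Pi.zero_apply, zero_smul, Finset.sum_const_zero, zero_add,
      Sum.elim_inr] at hy
    exact hbr y hy

lemma det_toRealMat (w : Matrix ι ι ℤ) : (toRealMat w).det = (w.det : ℝ) :=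
  (Int.cast_det w).symm

variable [Fintype κ] [DecidableEq κ]

lemma ColIndep.maxMinor_pos {w : Matrix κ ι ℤ} (hw : ColIndep w) :
    0 < maxMinor (toRealMat w) := by
  set c : Matrix κ ι ℚ := w.map (Int.cast : ℤ → ℚ) with hc
  have h1 : LinearIndependent ℤ c.col := by
    rw [Fintype.linearIndependent_iff]
    intro x hx
    refine fun b => congrFun (hw x ?_) b
    ext k
    have h2 := congrFun hx k
    simp only [Finset.sum_apply, Pi.zero_apply] at h2
    have h3 : (((w.mulVec x) k : ℤ) : ℚ) = 0 := by
      rw [← h2]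
      simp [Matrix.mulVec, dotProduct, mul_comm, hc]
    exact_mod_cast h3
  have h4 : Function.Injective c.mulVec :=
    Matrix.mulVec_injective_iff.mpr ((LinearIndependent.iff_fractionRing ℤ ℚ).mp h1)
  obtain ⟨g, hg⟩ := LinearMap.exists_leftInverse_of_injective (Matrix.toLin' c)
    (LinearMap.ker_eq_bot.mpr h4)
  have h5 : LinearMap.toMatrix' g * c = 1 := by
    have : LinearMap.toMatrix' (g.comp (Matrix.toLin' c)) = 1 := by
      rw [hg, LinearMap.toMatrix'_id]
    rwa [LinearMap.toMatrix'_comp, LinearMap.toMatrix'_toLin'] at this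
  refine maxMinor_pos_of_leftInverse (H := (LinearMap.toMatrix' g).map (Rat.castHom ℝ)) ?_
  have h6 : toRealMat w = c.map (Rat.castHom ℝ) := by
    ext k b
    simp [toRealMat, hc]
  rw [h6, ← Matrix.map_mul, h5]
  exact Matrix.map_one _ (map_zero _) (map_one _)

lemma ColIndep.one_le_maxMinor {w : Matrix κ ι ℤ} (hw : ColIndep w) :
    1 ≤ maxMinor (toRealMat w) := by
  rcases isEmpty_or_nonempty κ with hκ | hκ
  · have hι : IsEmpty ι := Fintype.card_eq_zero_iff.mp
      (Nat.le_zero.mp (hw.card_le.trans_eq Fintype.card_eq_zero))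
    have := abs_det_submatrix_le_maxMinor (toRealMat w) (fun a => isEmptyElim a)
    simpa using this
  obtain ⟨S, hS⟩ := exists_abs_det_eq_maxMinor (toRealMat w)
  have h1 : ((toRealMat w).submatrix S id) = toRealMat (w.submatrix S id) := rfl
  have h2 := hw.maxMinor_pos
  rw [← hS, h1, det_toRealMat] at h2 ⊢
  have h3 : 0 < |(w.submatrix S id).det| := by exact_mod_cast h2
  exact_mod_cast h3

end IntegerColumns

/-! ### Thick lattices -/

section Thick

variable {κ : Type*}

lemma ColIndep.submatrix_equiv {ι ι' : Type*} [Fintype ι] [Fintype ι'] {w : Matrix κ ι ℤ}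
    (hw : ColIndep w) (e : ι' ≃ ι) : ColIndep (w.submatrix id e) := by
  intro x hx
  have h1 : w.mulVec (x ∘ e.symm) = 0 := by
    rw [← hx, Matrix.submatrix_mulVec_equiv]
    rfl
  have h2 := hw _ h1
  ext b
  simpa using congrFun h2 (e b)

lemma exists_eq_mul_of_col_mem {ι γ : Type*} [Fintype ι] (W : Matrix κ ι ℝ) (E : Matrix κ γ ℝ)
    (h : ∀ c, E.col c ∈ LinearMap.range W.mulVecLin) : ∃ G : Matrix ι γ ℝ, E = W * G := by
  choose g hg using h
  refine ⟨Matrix.of fun b c => g c b, ?_⟩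
  ext k c
  have := congrFun (hg c) k
  exact this.symm

variable [Fintype κ] [DecidableEq κ]

/-- The lattice `B ℤ^κ` is unimodular and its subgroups of intermediate rank `i` have covolume at
least `ε ^ (i (d - i))`. The exponents are strictly concave in `i`, which forces subgroups that
nearly violate the bound to be unique in their rank. -/
def IsThick (ε : ℝ) (B : Matrix κ κ ℝ) : Prop :=
  B.det = 1 ∧ ∀ i, 0 < i → i < Fintype.card κ → ∀ w : Matrix κ (Fin i) ℤ, ColIndep w →
    ε ^ (i * (Fintype.card κ - i)) ≤ maxMinor (B * toRealMat w)

lemma IsThick.le_maxMinor {ε : ℝ} {B : Matrix κ κ ℝ} (hB : IsThick ε B) {ι : Type*} [Fintype ι]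
    [DecidableEq ι] {w : Matrix κ ι ℤ} (hw : ColIndep w) :
    ε ^ (Fintype.card ι * (Fintype.card κ - Fintype.card ι)) ≤ maxMinor (B * toRealMat w) := by
  rcases Nat.eq_zero_or_pos (Fintype.card ι) with h0 | h0
  · have hι : IsEmpty ι := Fintype.card_eq_zero_iff.mp h0
    have := abs_det_submatrix_le_maxMinor (B * toRealMat w) (fun a => isEmptyElim a)
    simpa using this
  rcases hw.card_le.lt_or_eq with hlt | heq
  · have h1 := hB.2 _ h0 hlt _ (hw.submatrix_equiv (Fintype.equivFin ι).symm)
    refine h1.trans_eq ?_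
    rw [← maxMinor_submatrix_equiv (Fintype.equivFin ι).symm (B * toRealMat w)]
    rfl
  · have e : ι ≃ κ := Fintype.equivOfCardEq heq
    have h1 := abs_det_submatrix_le_maxMinor (B * toRealMat w) e
    have h2 : (B * toRealMat w).submatrix e id
        = B.submatrix e e * (toRealMat (w.submatrix e id)) := by
      have := Matrix.submatrix_mul_equiv B (toRealMat w) e e id
      rw [← this]
      rfl
    rw [h2, Matrix.det_mul, Matrix.det_submatrix_equiv_self, hB.1, one_mul, det_toRealMat] at h1
    have h3 : (w.submatrix e id).det ≠ 0 := by
      intro h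
      obtain ⟨x, hx0, hx⟩ := Matrix.exists_mulVec_eq_zero_iff.mpr h
      refine hx0 (hw x ?_)
      ext k
      have := congrFun hx (e.symm k)
      simpa [Matrix.mulVec, dotProduct] using this
    have h4 : (1 : ℝ) ≤ |((w.submatrix e id).det : ℝ)| := by
      exact_mod_cast Int.one_le_abs h3
    simpa [heq] using h4.trans h1

lemma isThick_one {ε : ℝ} (hε : 0 ≤ ε) (hε' : ε ≤ 1) : IsThick ε (1 : Matrix κ κ ℝ) := by
  refine ⟨Matrix.det_one, fun i _ _ w hw => ?_⟩
  rw [Matrix.one_mul]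
  exact (pow_le_one₀ hε hε').trans hw.one_le_maxMinor

/-- In a thick lattice, two subgroups of the same rank and of nearly minimal covolume span the
same space: otherwise their intersection or their sum would be too small. -/
lemma IsThick.exists_eq_mul {ε c : ℝ} {B : Matrix κ κ ℝ} (hB : IsThick ε B) (hε : 0 < ε)
    (hε' : ε ≤ 1) (hc : ((Fintype.card κ).factorial : ℝ) * c ^ 2 * ε ^ 2 ≤ 1)
    {ι : Type*} [Fintype ι] [DecidableEq ι] [Nonempty κ] {w₀ w : Matrix κ ι ℤ}
    (hw₀ : ColIndep w₀) (hw : ColIndep w)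
    (h₀ : maxMinor (B * toRealMat w₀)
      < c * ε ^ (Fintype.card ι * (Fintype.card κ - Fintype.card ι)))
    (h : maxMinor (B * toRealMat w)
      < c * ε ^ (Fintype.card ι * (Fintype.card κ - Fintype.card ι))) :
    ∃ G : Matrix ι ι ℝ, toRealMat w = toRealMat w₀ * G := by
  refine exists_eq_mul_of_col_mem _ _ ?_
  by_contra hcon
  obtain ⟨a, j, U, e, hj, hU, hl, hr⟩ := exists_adapted_basis w _ hcon
  set we : Matrix κ (Fin a) ℤ := (w * U).submatrix id Sum.inl with hwe
  set wf : Matrix κ (Fin j) ℤ := (w * U).submatrix id Sum.inr with hwf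
  have hcols : w * U = Matrix.fromCols we wf := by
    ext k (b | b) <;> rfl
  have hcard : Fintype.card ι = a + j := by
    rw [Fintype.card_congr e]
    simp
  have hwU : ColIndep (w * U) := by
    intro x hx
    have h1 : U.mulVec x = 0 := hw _ (by rw [Matrix.mulVec_mulVec, hx])
    have h2 : (U.submatrix id e).mulVec (x ∘ e) = 0 := by
      rw [← h1, Matrix.submatrix_mulVec_equiv, Function.comp_assoc, Equiv.self_comp_symm]
      rfl
    have h3 : x ∘ e = 0 := by
      by_contra h4
      exact hU.ne_zero (Matrix.exists_mulVec_eq_zero_iff.mp ⟨_, h4, h2⟩)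
    ext b
    simpa using congrFun h3 (e.symm b)
  have hwe' : ColIndep we := by
    intro x hx
    have h1 := hwU (Sum.elim x 0) (by rw [hcols, Matrix.fromCols_mulVec]; simp [hx])
    ext b
    exact congrFun h1 (Sum.inl b)
  have hsum : ColIndep (Matrix.fromCols w₀ wf) := by
    intro x hx
    have h1 : w₀.mulVec (x ∘ Sum.inl) + wf.mulVec (x ∘ Sum.inr) = 0 := by
      rw [← Matrix.fromCols_mulVec]
      exact hx
    have h2 : x ∘ Sum.inr = 0 := by
      refine hr _ ?_
      rw [hcols, Matrix.fromCols_mulVec]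
      have h3 : wf.mulVec (x ∘ Sum.inr) = w₀.mulVec (-(x ∘ Sum.inl)) := by
        rw [Matrix.mulVec_neg]
        exact eq_neg_of_add_eq_zero_right h1
      refine ⟨fun b => (((-(x ∘ Sum.inl)) b : ℤ) : ℝ), ?_⟩
      rw [Matrix.mulVecLin_apply, toRealMat_mulVec, ← h3]
      simp
    rw [h2, Matrix.mulVec_zero, add_zero] at h1
    have h3 := hw₀ _ h1
    ext (b | b)
    · exact congrFun h3 b
    · exact congrFun h2 b
  obtain ⟨G, hG⟩ := exists_eq_mul_of_col_mem (toRealMat w₀) (toRealMat we) (fun b => hl b)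
  have hdetU : maxMinor (B * toRealMat (w * U)) = maxMinor (B * toRealMat w) := by
    rw [← maxMinor_submatrix_equiv e]
    have h1 : (B * toRealMat (w * U)).submatrix id e
        = (B * toRealMat w) * toRealMat (U.submatrix id e) := by
      rw [toRealMat_mul, ← Matrix.mul_assoc]
      rfl
    rw [h1, maxMinor_mul_right, det_toRealMat]
    rcases Int.isUnit_iff.mp hU with h2 | h2 <;> simp [h2]
  have hBsum : B * toRealMat (Matrix.fromCols w₀ wf)
      = Matrix.fromCols (B * toRealMat w₀) (B * toRealMat wf) := by
    rw [← Matrix.mul_fromCols]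
    congr 1
    ext k (b | b) <;> rfl
  have hBwU : B * toRealMat (w * U) = Matrix.fromCols (B * toRealMat we) (B * toRealMat wf) := by
    rw [← Matrix.mul_fromCols, hcols]
    congr 1
    ext k (b | b) <;> rfl
  have l1 := hB.le_maxMinor hwe'
  have l2 := hB.le_maxMinor hsum
  have l0 := hB.le_maxMinor hw₀
  have hd : Fintype.card ι + j ≤ Fintype.card κ := by
    have := hsum.card_le
    simpa using this
  have hsub := maxMinor_submodular (B * toRealMat wf) ((pow_pos hε _).trans_le l1)
    ((pow_pos hε _).trans_le l0) (G := G) (by rw [hG, Matrix.mul_assoc])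
  rw [← hBsum, ← hBwU, hdetU] at hsub
  simp only [Fintype.card_fin, Fintype.card_sum] at l1 l2 hsub
  obtain ⟨r, hr'⟩ := Nat.exists_eq_add_of_le hd
  have e1 : Fintype.card κ - a = 2 * j + r := by omega
  have e2 : Fintype.card κ - (Fintype.card ι + j) = r := by omega
  have e3 : Fintype.card κ - Fintype.card ι = j + r := by omega
  rw [e1] at l1
  rw [e2] at l2
  rw [e3] at h h₀
  rw [hcard] at l2 h h₀
  set θ := ε ^ ((a + j) * (j + r)) with hθ
  have hθ0 : 0 < θ := pow_pos hε _
  have hf : ((Fintype.card ι + j).factorial : ℝ) ≤ (Fintype.card κ).factorial := by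
    exact_mod_cast Nat.factorial_le hd
  have h1 : maxMinor (B * toRealMat w₀) * maxMinor (B * toRealMat w) < (c * θ) * (c * θ) :=
    mul_lt_mul'' h₀ h (maxMinor_nonneg _) (maxMinor_nonneg _)
  have h2 : ε ^ (a * (2 * j + r)) * ε ^ ((a + j + j) * r)
      < (Fintype.card κ).factorial * ((c * θ) * (c * θ)) := by
    refine lt_of_le_of_lt ((mul_le_mul l1 l2 (pow_pos hε _).le (maxMinor_nonneg _)).trans hsub) ?_
    refine lt_of_le_of_lt (mul_le_mul_of_nonneg_right hf
      (mul_nonneg (maxMinor_nonneg _) (maxMinor_nonneg _))) ?_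
    exact mul_lt_mul_of_pos_left h1 (by positivity)
  have h3 : ε ^ (a * (2 * j + r)) * ε ^ ((a + j + j) * r) * ε ^ (2 * j ^ 2) = θ * θ := by
    rw [hθ, ← pow_add, ← pow_add, ← pow_add]
    congr 1
    ring
  have h4 : ε ^ (2 * j ^ 2) ≤ ε ^ 2 := by
    refine pow_le_pow_of_le_one hε.le hε' ?_
    nlinarith
  have h5 : θ * θ < (Fintype.card κ).factorial * ((c * θ) * (c * θ)) * ε ^ (2 * j ^ 2) := by
    rw [← h3]
    exact mul_lt_mul_of_pos_right h2 (pow_pos hε _)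
  have h6 : (Fintype.card κ).factorial * ((c * θ) * (c * θ)) * ε ^ (2 * j ^ 2)
      ≤ (((Fintype.card κ).factorial : ℝ) * c ^ 2 * ε ^ 2) * (θ * θ) := by
    calc (Fintype.card κ).factorial * ((c * θ) * (c * θ)) * ε ^ (2 * j ^ 2)
        ≤ (Fintype.card κ).factorial * ((c * θ) * (c * θ)) * ε ^ 2 := by
          refine mul_le_mul_of_nonneg_left h4 ?_
          exact mul_nonneg (by positivity) (mul_self_nonneg _)
      _ = _ := by ring
  have h7 := mul_le_mul_of_nonneg_right hc (mul_pos hθ0 hθ0).le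
  linarith

/-- If one step distorts covolumes by at most `c`, then only one subgroup in each rank matters
for the thickness of the image. -/
lemma IsThick.exists_witness {ε c : ℝ} {B : Matrix κ κ ℝ} (hB : IsThick ε B) (hε : 0 < ε)
    (hε' : ε ≤ 1) (hc1 : 0 < c) (hc : ((Fintype.card κ).factorial : ℝ) * c ^ 2 * ε ^ 2 ≤ 1)
    [Nonempty κ] (i : ℕ) (hi0 : 0 < i) (hi : i < Fintype.card κ) :
    ∃ W : Matrix κ (Fin i) ℝ, 0 < maxMinor W ∧ ∀ T : Matrix κ κ ℝ,
      (∀ V : Matrix κ (Fin i) ℝ, maxMinor V ≤ c * maxMinor (T * V)) →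
      maxMinor W ≤ maxMinor (T * W) → ∀ w : Matrix κ (Fin i) ℤ, ColIndep w →
      ε ^ (i * (Fintype.card κ - i)) ≤ maxMinor (T * B * toRealMat w) := by
  by_cases hex : ∃ w₀ : Matrix κ (Fin i) ℤ, ColIndep w₀ ∧
      maxMinor (B * toRealMat w₀) < c * ε ^ (i * (Fintype.card κ - i))
  · obtain ⟨w₀, hw₀, hlt⟩ := hex
    refine ⟨B * toRealMat w₀, (pow_pos hε _).trans_le (hB.2 i hi0 hi w₀ hw₀),
      fun T hT hW w hw => ?_⟩
    by_cases hlt' : maxMinor (B * toRealMat w) < c * ε ^ (i * (Fintype.card κ - i))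
    · obtain ⟨G, hG⟩ := hB.exists_eq_mul hε hε' hc hw₀ hw (by simpa using hlt) (by simpa using hlt')
      have h1 := hB.2 i hi0 hi w hw
      rw [hG, ← Matrix.mul_assoc, maxMinor_mul_right] at h1
      rw [hG, ← Matrix.mul_assoc, maxMinor_mul_right, Matrix.mul_assoc T B]
      exact h1.trans (mul_le_mul_of_nonneg_right hW (abs_nonneg _))
    · have h1 := (not_lt.mp hlt').trans (hT (B * toRealMat w))
      rw [← Matrix.mul_assoc] at h1
      exact le_of_mul_le_mul_left h1 hc1
  · push Not at hex
    have hpos : ∃ W : Matrix κ (Fin i) ℝ, 0 < maxMinor W := by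
      obtain ⟨f⟩ : Nonempty (Fin i ↪ κ) := by
        rw [Function.Embedding.nonempty_iff_card_le]
        simpa using hi.le
      refine ⟨(1 : Matrix κ κ ℝ).submatrix id f, ?_⟩
      have h1 := abs_det_submatrix_le_maxMinor ((1 : Matrix κ κ ℝ).submatrix id f) f
      rw [Matrix.submatrix_submatrix] at h1
      have h2 : (1 : Matrix κ κ ℝ).submatrix (id ∘ f) (f ∘ id) = 1 :=
        Matrix.submatrix_one f f.injective
      rw [h2] at h1
      simp at h1
      linarith
    obtain ⟨W, hW⟩ := hpos
    refine ⟨W, hW, fun T hT _ w hw => ?_⟩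
    have h1 := (hex w hw).trans (hT (B * toRealMat w))
    rw [← Matrix.mul_assoc] at h1
    exact le_of_mul_le_mul_left h1 hc1

end Thick

/-! ### Most renormalization steps preserve thickness -/

section Step

variable {κ μ : Type*} [Fintype κ] [DecidableEq κ] [Fintype μ] [DecidableEq μ]

/-- One step shrinks covolumes at most by a factor depending only on the scale and the number of
digits. -/
lemma exists_distortion_bound (R : ℝ) (hR : 0 < R) (L : ℕ) : ∃ c : ℝ, 0 < c ∧
    ∀ (t : μ × κ → Fin L) (i : ℕ), i < Fintype.card (κ ⊕ μ) →
      ∀ V : Matrix (κ ⊕ μ) (Fin i) ℝ, maxMinor V ≤ c * maxMinor (renorm R (digitShift t) * V) := by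
  let s : (μ × κ → Fin L) → ℝ := fun t =>
    1 + ∑ k, ∑ l, |(renorm R (digitShift t))⁻¹ k l|
  have hs : ∀ t, 1 ≤ s t := fun t => le_add_of_nonneg_right
    (Finset.sum_nonneg fun _ _ => Finset.sum_nonneg fun _ _ => abs_nonneg _)
  have hs0 : ∀ t, 0 ≤ s t := fun t => zero_le_one.trans (hs t)
  refine ⟨1 + ∑ t, s t ^ Fintype.card (κ ⊕ μ), ?_, fun t i hi V => ?_⟩
  · have : 0 ≤ ∑ t, s t ^ Fintype.card (κ ⊕ μ) := Finset.sum_nonneg fun t _ => pow_nonneg (hs0 t) _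
    linarith
  · have hV : V = (renorm R (digitShift t))⁻¹ * (renorm R (digitShift t) * V) := by
      rw [← Matrix.mul_assoc, Matrix.nonsing_inv_mul, Matrix.one_mul]
      rw [det_renorm hR]
      exact isUnit_one
    have h1 := maxMinor_mul_left_le (renorm R (digitShift t))⁻¹ (renorm R (digitShift t) * V)
      (c := s t) (fun k => by
        have := Finset.single_le_sum (f := fun k => ∑ l, |(renorm R (digitShift t))⁻¹ k l|)
          (fun k _ => Finset.sum_nonneg fun _ _ => abs_nonneg _) (Finset.mem_univ k)
        simp only [s]
        linarith) (hs0 t)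
    rw [← hV, Fintype.card_fin] at h1
    refine h1.trans (mul_le_mul_of_nonneg_right ?_ (maxMinor_nonneg _))
    have h2 := Finset.single_le_sum (f := fun t => s t ^ Fintype.card (κ ⊕ μ))
      (fun t _ => pow_nonneg (hs0 t) _) (Finset.mem_univ t)
    have h3 := pow_le_pow_right₀ (hs t) hi.le
    linarith

/-- For large scales, at least half of the renormalization steps preserve thickness. -/
theorem exists_isThick_half [Nonempty κ] [Nonempty μ] : ∃ R₀ : ℝ, ∀ R : ℝ, R₀ ≤ R →
    1 ≤ R → ∀ L : ℕ, 4 * Fintype.card (κ ⊕ μ) * Fintype.card (μ × κ) ≤ L →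
    ∃ ε : ℝ, 0 < ε ∧ ε ≤ 1 ∧ ∀ B : Matrix (κ ⊕ μ) (κ ⊕ μ) ℝ, IsThick ε B →
      L ^ Fintype.card (μ × κ) ≤
        2 * Nat.card {t : μ × κ → Fin L // IsThick ε (renorm R (digitShift t) * B)} := by
  set d := Fintype.card (κ ⊕ μ) with hd
  set D := Fintype.card (μ × κ) with hD
  have hd0 : 0 < d := Fintype.card_pos
  have hD0 : 0 < D := Fintype.card_pos
  have hd1 : (1 : ℝ) ≤ d := by exact_mod_cast hd0
  have hD1 : (1 : ℝ) ≤ D := by exact_mod_cast hD0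
  set η : ℝ := 1 / (16 * d ^ 2 * D) with hη
  have hη0 : 0 < η := by positivity
  have hη1 : η ≤ 1 / 2 := by
    rw [hη]
    refine one_div_le_one_div_of_le two_pos ?_
    have : (1 : ℝ) ≤ d ^ 2 * D := by
      have := mul_le_mul (one_le_pow₀ hd1 (n := 2)) hD1 zero_le_one (by positivity)
      linarith
    linarith
  refine ⟨2 ^ d / η ^ D, fun R hR hR1 L hL => ?_⟩
  have hR0 : 0 < R := one_pos.trans_le hR1
  have hL0 : 0 < L := lt_of_lt_of_le (by positivity) hL
  obtain ⟨c, hc0, hc⟩ := exists_distortion_bound (κ := κ) (μ := μ) R hR0 L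
  obtain ⟨ε, hε0, hε1, hεc⟩ : ∃ ε : ℝ, 0 < ε ∧ ε ≤ 1 ∧ (d.factorial : ℝ) * c ^ 2 * ε ^ 2 ≤ 1 := by
    set K : ℝ := d.factorial * c ^ 2 with hK
    have hK0 : 0 ≤ K := by positivity
    refine ⟨1 / (1 + K), by positivity, ?_, ?_⟩
    · rw [div_le_one (by positivity)]
      linarith
    · rw [div_pow, one_pow, mul_one_div, div_le_one (by positivity)]
      nlinarith
  refine ⟨ε, hε0, hε1, fun B hB => ?_⟩
  classical
  have hwit := fun i (hi0 : 0 < i) (hi : i < d) =>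
    hB.exists_witness hε0 hε1 hc0 hεc i hi0 hi
  choose W hW0 hW using hwit
  let bad : Finset (μ × κ → Fin L) := (Finset.Ioo 0 d).attach.biUnion fun i =>
    Finset.univ.filter fun t =>
      maxMinor (renorm R (digitShift t) * W i.1 (Finset.mem_Ioo.mp i.2).1 (Finset.mem_Ioo.mp i.2).2)
        < maxMinor (W i.1 (Finset.mem_Ioo.mp i.2).1 (Finset.mem_Ioo.mp i.2).2)
  let good : Finset (μ × κ → Fin L) :=
    Finset.univ.filter fun t => IsThick ε (renorm R (digitShift t) * B)
  have hcover : ∀ t, t ∈ bad ∨ t ∈ good := by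
    intro t
    by_cases ht : t ∈ bad
    · exact Or.inl ht
    right
    simp only [good, Finset.mem_filter, Finset.mem_univ, true_and]
    refine ⟨by rw [Matrix.det_mul, det_renorm hR0, hB.1, one_mul], fun i hi0 hi w hw => ?_⟩
    refine hW i hi0 hi _ (hc t i hi) ?_ w hw
    by_contra hcon
    refine ht (Finset.mem_biUnion.mpr ⟨⟨i, Finset.mem_Ioo.mpr ⟨hi0, hi⟩⟩,
      Finset.mem_attach _ _, ?_⟩)
    simpa using not_le.mp hcon
  have hbad : (bad.card : ℝ) * L ≤ d * (D * (4 * η * d * L + 1) * (L : ℝ) ^ D) := by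
    have h1 : (bad.card : ℝ) ≤ ∑ i ∈ (Finset.Ioo 0 d).attach,
        ((Finset.univ.filter fun t : μ × κ → Fin L =>
          maxMinor (renorm R (digitShift t)
            * W i.1 (Finset.mem_Ioo.mp i.2).1 (Finset.mem_Ioo.mp i.2).2)
          < maxMinor (W i.1 (Finset.mem_Ioo.mp i.2).1 (Finset.mem_Ioo.mp i.2).2)).card : ℝ) := by
      exact_mod_cast Finset.card_biUnion_le
    refine (mul_le_mul_of_nonneg_right h1 (Nat.cast_nonneg L)).trans ?_
    rw [Finset.sum_mul]
    have h2 : ∀ i ∈ (Finset.Ioo 0 d).attach,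
        ((Finset.univ.filter fun t : μ × κ → Fin L =>
          maxMinor (renorm R (digitShift t)
            * W i.1 (Finset.mem_Ioo.mp i.2).1 (Finset.mem_Ioo.mp i.2).2)
          < maxMinor (W i.1 (Finset.mem_Ioo.mp i.2).1 (Finset.mem_Ioo.mp i.2).2)).card : ℝ) * L
        ≤ D * (4 * η * d * L + 1) * (L : ℝ) ^ D := by
      intro i _
      obtain ⟨hi0, hi⟩ := Finset.mem_Ioo.mp i.2
      have hi' : (i.1 : ℝ) + 1 ≤ d := by exact_mod_cast hi
      have h3 := card_shrinking_le hR1 hη0 hη1 hL0 (W i.1 hi0 hi) (hW0 i.1 hi0 hi)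
        (by simpa using hi0) (by simpa [hd] using hi) (by
          rw [Fintype.card_fin]
          rw [div_le_iff₀ (by positivity)] at hR
          exact (pow_le_pow_right₀ one_le_two hi.le).trans hR)
      rw [Fintype.card_fin] at h3
      refine h3.trans ?_
      gcongr
    refine (Finset.sum_le_card_nsmul _ _ _ h2).trans ?_
    rw [nsmul_eq_mul]
    refine mul_le_mul_of_nonneg_right ?_ (by positivity)
    rw [Finset.card_attach, Nat.card_Ioo]
    exact_mod_cast (by omega : d - 0 - 1 ≤ d)
  have hhalf : 2 * (bad.card : ℝ) ≤ (L : ℝ) ^ D := by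
    have hL' : (0 : ℝ) < L := by exact_mod_cast hL0
    have hL4 : 4 * (d : ℝ) * D ≤ L := by exact_mod_cast hL
    have h1 : (d : ℝ) * (D * (4 * η * d * L + 1) * (L : ℝ) ^ D) ≤ (L / 2) * (L : ℝ) ^ D := by
      rw [← mul_assoc]
      refine mul_le_mul_of_nonneg_right ?_ (by positivity)
      have h2 : (d : ℝ) * (D * (4 * η * d * L + 1)) = L / 4 + d * D := by
        rw [hη]
        field_simp
        ring
      rw [h2]
      linarith
    have h3 := hbad.trans h1
    have h4 : 2 * (bad.card : ℝ) * L ≤ (L : ℝ) ^ D * L := by linarith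
    exact le_of_mul_le_mul_right h4 hL'
  have hcard : L ^ D ≤ bad.card + good.card := by
    have h1 : (Finset.univ : Finset (μ × κ → Fin L)) ⊆ bad ∪ good := fun t _ =>
      Finset.mem_union.mpr (hcover t)
    have h2 := (Finset.card_le_card h1).trans (Finset.card_union_le _ _)
    simpa [hD] using h2
  have hhalf' : 2 * bad.card ≤ L ^ D := by exact_mod_cast hhalf
  have hgood : Nat.card {t : μ × κ → Fin L // IsThick ε (renorm R (digitShift t) * B)}
      = good.card := by
    rw [Nat.card_eq_fintype_card, Fintype.card_subtype]
  rw [hgood]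
  omega

end Step

/-! ### Dimension of tree-like sets -/

section Tree

/-- The state reached after `k` steps along a sequence of choices. -/
def stateSeq {St H : Type*} (step : St → H → St) (s₀ : St) (σ : ℕ → H) : ℕ → St
  | 0 => s₀
  | k + 1 => step (stateSeq step s₀ σ k) (σ k)

lemma stateSeq_congr {St H : Type*} (step : St → H → St) (s₀ : St) {σ τ : ℕ → H} {k : ℕ}
    (h : ∀ i < k, σ i = τ i) : stateSeq step s₀ σ k = stateSeq step s₀ τ k := by
  induction k with
  | zero => rfl
  | succ k ih =>
    rw [stateSeq, stateSeq, ih fun i hi => h i (hi.trans k.lt_succ_self), h k k.lt_succ_self]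

/-- If every admissible state has at least `m` admissible successors, then each sequence of
addresses in `{0, …, m - 1}` selects an admissible path, and distinct addresses part at the same
step as their paths. -/
lemma exists_path_selection {St H : Type*} [Finite H] (step : St → H → St) (P : St → Prop)
    {s₀ : St} (h₀ : P s₀) {m : ℕ} (hm : 0 < m)
    (hstep : ∀ s, P s → m ≤ Nat.card {h // P (step s h)}) :
    ∃ path : (ℕ → Fin m) → ℕ → H, (∀ α k, P (stateSeq step s₀ (path α) k)) ∧
      ∀ α β k, (∀ i < k, α i = β i) → α k ≠ β k →
        (∀ i < k, path α i = path β i) ∧ path α k ≠ path β k := by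
  have hg : ∀ s, P s → ∃ g : Fin m → H, Function.Injective g ∧ ∀ a, P (step s (g a)) := by
    intro s hs
    have := Fintype.ofFinite {h // P (step s h)}
    obtain ⟨f⟩ : Nonempty (Fin m ↪ {h // P (step s h)}) := by
      rw [Function.Embedding.nonempty_iff_card_le, Fintype.card_fin, ← Nat.card_eq_fintype_card]
      exact hstep s hs
    exact ⟨fun a => f a, fun a b hab => f.injective (Subtype.ext hab), fun a => (f a).2⟩
  have hH : Nonempty H := by
    obtain ⟨g, -⟩ := hg s₀ h₀
    exact ⟨g ⟨0, hm⟩⟩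
  choose! g hginj hgP using hg
  let st : (ℕ → Fin m) → ℕ → St := fun α => stateSeq (fun s a => step s (g s a)) s₀ α
  let path : (ℕ → Fin m) → ℕ → H := fun α k => g (st α k) (α k)
  have hst : ∀ α k, stateSeq step s₀ (path α) k = st α k := by
    intro α k
    induction k with
    | zero => rfl
    | succ k ih => rw [stateSeq, ih]; rfl
  have hP : ∀ α k, P (st α k) := by
    intro α k
    induction k with
    | zero => exact h₀
    | succ k ih => exact hgP _ ih _
  refine ⟨path, fun α k => by rw [hst]; exact hP α k, fun α β k hlt hne => ?_⟩
  have hst' : ∀ i ≤ k, st α i = st β i := fun i hi =>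
    stateSeq_congr _ _ fun j hj => hlt j (hj.trans_le hi)
  refine ⟨fun i hi => ?_, fun h => hne ?_⟩
  · simp only [path]
    rw [hst' i hi.le, hlt i hi]
  · simp only [path] at h
    rw [hst' k le_rfl] at h
    exact hginj _ (hP β k) h

/-- Lower bound for the dimension of a tree-like set: `m` admissible successors at every node,
and paths which part at step `k` have limits at distance at least a constant times `b ^ (-k)`.
The map sending the limit of a path to the number in `[0, 1]` with the address of the path as
base `m` expansion is onto and Hölder continuous of exponent `log m / log b`. -/
theorem le_dimH_of_tree {St H E : Type*} [Finite H] [MetricSpace E] (step : St → H → St)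
    (P : St → Prop) {s₀ : St} (h₀ : P s₀) {m b : ℕ} (hm : 1 < m) (hb : 0 < b)
    (hstep : ∀ s, P s → m ≤ Nat.card {h // P (step s h)}) (F : (ℕ → H) → E) {c : ℝ} (hc : 0 < c)
    (hF : ∀ σ τ k, (∀ i < k, σ i = τ i) → σ k ≠ τ k → c * ((b : ℝ) ^ k)⁻¹ ≤ dist (F σ) (F τ))
    {s : NNReal} (hs : 0 < s) (hbs : (b : ℝ) ^ (s : ℝ) ≤ m) :
    (s : ENNReal) ≤ dimH (F '' {σ | ∀ k, P (stateSeq step s₀ σ k)}) := by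
  obtain ⟨path, hpath, hsep⟩ := exists_path_selection step P h₀ (zero_lt_one.trans hm) hstep
  have hm0 : (0 : ℝ) < m := by exact_mod_cast (zero_lt_one.trans hm)
  have hb0 : (0 : ℝ) < b := by exact_mod_cast hb
  let Φ : (ℕ → Fin m) → E := fun α => F (path α)
  have hfirst : ∀ α β : ℕ → Fin m, α ≠ β → ∃ k, (∀ i < k, α i = β i) ∧ α k ≠ β k := by
    intro α β h
    have hex : ∃ k, α k ≠ β k := Function.ne_iff.mp h
    classical
    exact ⟨Nat.find hex, fun i hi => not_not.mp (Nat.find_min hex hi), Nat.find_spec hex⟩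
  have hdist : ∀ α β, α ≠ β → ∃ k : ℕ, c * ((b : ℝ) ^ k)⁻¹ ≤ dist (Φ α) (Φ β) ∧
      |Real.ofDigits α - Real.ofDigits β| ≤ ((m : ℝ) ^ k)⁻¹ := by
    intro α β h
    obtain ⟨k, hlt, hne⟩ := hfirst α β h
    obtain ⟨h1, h2⟩ := hsep α β k hlt hne
    exact ⟨k, hF _ _ k h1 h2, Real.abs_ofDigits_sub_ofDigits_le hlt⟩
  have hinj : Function.Injective Φ := by
    intro α β h
    by_contra hne
    obtain ⟨k, hk, -⟩ := hdist α β hne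
    rw [h, dist_self] at hk
    have : 0 < c * ((b : ℝ) ^ k)⁻¹ := by positivity
    linarith
  have hne : Nonempty (ℕ → Fin m) := ⟨fun _ => ⟨0, zero_lt_one.trans hm⟩⟩
  let Ψ : E → ℝ := fun x => Real.ofDigits (Function.invFun Φ x)
  have hΨ : ∀ α, Ψ (Φ α) = Real.ofDigits α := fun α => by
    simp only [Ψ, Function.leftInverse_invFun hinj α]
  have hhold : HolderOnWith (Real.toNNReal ((c⁻¹) ^ (s : ℝ))) s Ψ (Set.range Φ) := by
    rintro _ ⟨α, rfl⟩ _ ⟨β, rfl⟩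
    by_cases hαβ : α = β
    · subst hαβ
      simp
    obtain ⟨k, hk1, hk2⟩ := hdist α β hαβ
    rw [hΨ, hΨ, edist_dist, edist_dist, Real.dist_eq]
    have hD : 0 ≤ dist (Φ α) (Φ β) := dist_nonneg
    rw [ENNReal.ofReal_rpow_of_nonneg hD s.coe_nonneg]
    have : ((Real.toNNReal ((c⁻¹) ^ (s : ℝ)) : NNReal) : ENNReal)
        = ENNReal.ofReal ((c⁻¹) ^ (s : ℝ)) := rfl
    rw [this, ← ENNReal.ofReal_mul (by positivity)]
    refine ENNReal.ofReal_le_ofReal (hk2.trans ?_)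
    rw [← Real.mul_rpow (by positivity) hD]
    have h1 : ((b : ℝ) ^ k)⁻¹ ≤ c⁻¹ * dist (Φ α) (Φ β) := by
      rw [inv_mul_eq_div, le_div_iff₀ hc, mul_comm]
      exact hk1
    refine le_trans ?_ (Real.rpow_le_rpow (by positivity) h1 s.coe_nonneg)
    rw [Real.inv_rpow (by positivity), ← Real.rpow_natCast (b : ℝ) k, ← Real.rpow_mul hb0.le,
      mul_comm (k : ℝ), Real.rpow_mul hb0.le, Real.rpow_natCast]
    exact inv_anti₀ (by positivity) (pow_le_pow_left₀ (by positivity) hbs k)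
  have himg : Set.Icc (0 : ℝ) 1 ⊆ Ψ '' Set.range Φ := by
    intro x hx
    obtain ⟨α, -, rfl⟩ := Real.ofDigits_SurjOn hm hx
    exact ⟨Φ α, ⟨α, rfl⟩, hΨ α⟩
  have h1 : (1 : ENNReal) ≤ dimH (Ψ '' Set.range Φ) := by
    have h2 : dimH (Set.Icc (0 : ℝ) 1) = 1 := by
      have := Real.dimH_of_nonempty_interior (E := ℝ) (s := Set.Icc 0 1) (by
        rw [interior_Icc]
        exact ⟨1 / 2, by norm_num, by norm_num⟩)
      simpa using this
    rw [← h2]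
    exact dimH_mono himg
  have h2 := h1.trans (hhold.dimH_image_le hs)
  have h3 : (s : ENNReal) ≤ dimH (Set.range Φ) := by
    have := (ENNReal.le_div_iff_mul_le (Or.inl (by exact_mod_cast hs.ne'))
      (Or.inl ENNReal.coe_ne_top)).mp h2
    rwa [one_mul] at this
  refine h3.trans (dimH_mono ?_)
  rintro _ ⟨α, rfl⟩
  exact ⟨path α, hpath α, rfl⟩

end Tree

/-! ### Expansions with even digits -/

section Digits

/-- The real number with base `2 * L` digits `2 t₀, 2 t₁, …`. Only even digits are used, so that
numbers with distinct digits are far apart. -/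
noncomputable def evenDigits {L : ℕ} (t : ℕ → Fin L) : ℝ :=
  Real.ofDigits (b := 2 * L) fun k => ⟨2 * (t k : ℕ), by have := (t k).2; omega⟩

lemma evenDigits_nonneg {L : ℕ} (t : ℕ → Fin L) : 0 ≤ evenDigits t := Real.ofDigits_nonneg _

lemma evenDigits_le_one {L : ℕ} (t : ℕ → Fin L) : evenDigits t ≤ 1 := Real.ofDigits_le_one _

lemma evenDigits_eq_sum_add {L : ℕ} (t : ℕ → Fin L) (k : ℕ) :
    evenDigits t = ∑ i ∈ Finset.range k, ((t i : ℕ) / L : ℝ) * (((2 * L : ℕ) : ℝ) ^ i)⁻¹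
      + (((2 * L : ℕ) : ℝ) ^ k)⁻¹ * evenDigits fun i => t (i + k) := by
  have hL : (L : ℝ) ≠ 0 := by
    have := (t 0).pos
    positivity
  unfold evenDigits
  rw [Real.ofDigits_eq_sum_add_ofDigits _ k]
  congr 1
  refine Finset.sum_congr rfl fun i _ => ?_
  simp only [Real.ofDigitsTerm]
  push_cast
  rw [pow_succ]
  field_simp

lemma evenDigits_separated {L : ℕ} {t t' : ℕ → Fin L} {k : ℕ} (h : ∀ i < k, t i = t' i)
    (hk : t k ≠ t' k) : (((2 * L : ℕ) : ℝ) ^ (k + 1))⁻¹ ≤ |evenDigits t - evenDigits t'| := by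
  have hL : (0 : ℝ) < L := by
    have := (t 0).pos
    positivity
  set b : ℝ := ((2 * L : ℕ) : ℝ) with hb
  have hb0 : 0 < b := by rw [hb]; push_cast; positivity
  rw [evenDigits_eq_sum_add t (k + 1), evenDigits_eq_sum_add t' (k + 1), Finset.sum_range_succ,
    Finset.sum_range_succ, Finset.sum_congr rfl fun i hi => by rw [h i (Finset.mem_range.mp hi)]]
  set x := evenDigits fun i => t (i + (k + 1))
  set y := evenDigits fun i => t' (i + (k + 1))
  have hx : |x - y| ≤ 1 := by
    have h1 := evenDigits_nonneg fun i => t (i + (k + 1))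
    have h2 := evenDigits_le_one fun i => t (i + (k + 1))
    have h3 := evenDigits_nonneg fun i => t' (i + (k + 1))
    have h4 := evenDigits_le_one fun i => t' (i + (k + 1))
    rw [abs_le]
    constructor <;> linarith
  have hint : (1 : ℝ) ≤ |((t k : ℕ) : ℝ) - ((t' k : ℕ) : ℝ)| := by
    have : ((t k : ℕ) : ℤ) - ((t' k : ℕ) : ℤ) ≠ 0 := by
      intro h0
      exact hk (Fin.ext (by omega))
    exact_mod_cast Int.one_le_abs this
  have hexp : ∀ S : ℝ, S + ((t k : ℕ) / L : ℝ) * (b ^ k)⁻¹ + (b ^ (k + 1))⁻¹ * x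
      - (S + ((t' k : ℕ) / L : ℝ) * (b ^ k)⁻¹ + (b ^ (k + 1))⁻¹ * y)
      = (b ^ (k + 1))⁻¹ * (2 * (((t k : ℕ) : ℝ) - ((t' k : ℕ) : ℝ)) + (x - y)) := by
    intro S
    have hbL : b = 2 * L := by rw [hb]; push_cast; ring
    have e1 : ((L : ℝ))⁻¹ * (b ^ k)⁻¹ = 2 * (b ^ (k + 1))⁻¹ := by
      rw [pow_succ, hbL]
      field_simp
    simp only [div_eq_mul_inv]
    linear_combination (((t k : ℕ) : ℝ) - ((t' k : ℕ) : ℝ)) * e1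
  rw [hexp, abs_mul, abs_of_pos (inv_pos.mpr (pow_pos hb0 _))]
  refine le_mul_of_one_le_right (inv_pos.mpr (pow_pos hb0 _)).le ?_
  have h5 := abs_sub_abs_le_abs_sub (2 * (((t k : ℕ) : ℝ) - ((t' k : ℕ) : ℝ))) (-(x - y))
  rw [abs_neg, sub_neg_eq_add, abs_mul, abs_two] at h5
  linarith

end Digits

/-! ### Matrices with prescribed digits -/

section LimitMatrix

variable {κ μ : Type*}

/-- The matrix whose entries have the even digits prescribed by `σ`. -/
noncomputable def limitMatrix {L : ℕ} (σ : ℕ → μ × κ → Fin L) : μ → κ → ℝ :=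
  fun i j => evenDigits fun l => σ l (i, j)

lemma limitMatrix_nonneg {L : ℕ} (σ : ℕ → μ × κ → Fin L) (i : μ) (j : κ) :
    0 ≤ limitMatrix σ i j := evenDigits_nonneg _

lemma limitMatrix_le_one {L : ℕ} (σ : ℕ → μ × κ → Fin L) (i : μ) (j : κ) :
    limitMatrix σ i j ≤ 1 := evenDigits_le_one _

/-- The truncation of `limitMatrix σ` after `k` digits. -/
noncomputable def truncatedMatrix {L : ℕ} (σ : ℕ → μ × κ → Fin L) (k : ℕ) : μ → κ → ℝ :=
  fun i j => ∑ l ∈ Finset.range k, ((σ l (i, j) : ℕ) / L : ℝ) * (((2 * L : ℕ) : ℝ) ^ l)⁻¹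

lemma abs_limitMatrix_sub_truncatedMatrix_le {L : ℕ} (σ : ℕ → μ × κ → Fin L) (k : ℕ)
    (i : μ) (j : κ) :
    |limitMatrix σ i j - truncatedMatrix σ k i j| ≤ (((2 * L : ℕ) : ℝ) ^ k)⁻¹ := by
  rw [limitMatrix, truncatedMatrix, evenDigits_eq_sum_add _ k, add_sub_cancel_left, abs_mul,
    abs_of_nonneg (evenDigits_nonneg _), abs_of_nonneg (by positivity)]
  exact mul_le_of_le_one_right (by positivity) (evenDigits_le_one _)

end LimitMatrix

/-! ### Thick trajectories and badly approximable matrices -/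

section Trajectory

variable {κ μ : Type*} [Fintype κ] [DecidableEq κ] [Fintype μ] [DecidableEq μ]

lemma renorm_mulVec_inl (R : ℝ) (h : μ → κ → ℝ) (v : κ ⊕ μ → ℝ) (j : κ) :
    (renorm R h).mulVec v (Sum.inl j)
      = R ^ Fintype.card μ * (v (Sum.inl j) + ∑ i, v (Sum.inr i) * h i j) := by
  rw [renorm, ← Matrix.mulVec_mulVec, Matrix.mulVec_diagonal]
  simp [shear, flowWeight, Matrix.mulVec, dotProduct, Matrix.one_apply, mul_comm]

lemma renorm_mulVec_inr (R : ℝ) (h : μ → κ → ℝ) (v : κ ⊕ μ → ℝ) (i : μ) :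
    (renorm R h).mulVec v (Sum.inr i) = (R ^ Fintype.card κ)⁻¹ * v (Sum.inr i) := by
  rw [renorm, ← Matrix.mulVec_mulVec, Matrix.mulVec_diagonal]
  simp [shear, flowWeight, Matrix.fromBlocks_mulVec]

/-- One step of the dynamics on lattices: renormalization by the shear attached to a digit. -/
noncomputable def latticeStep (R : ℝ) {L : ℕ} (B : Matrix (κ ⊕ μ) (κ ⊕ μ) ℝ)
    (t : μ × κ → Fin L) : Matrix (κ ⊕ μ) (κ ⊕ μ) ℝ := renorm R (digitShift t) * B

/-- The lattice reached after `k` steps is the image of the integer lattice under the shear by the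
truncated matrix, followed by the `k`-th power of the flow. -/
lemma stateSeq_latticeStep_mulVec {R : ℝ} (hR : 0 < R) {L : ℕ}
    (hL : R ^ (Fintype.card κ + Fintype.card μ) = ((2 * L : ℕ) : ℝ))
    (σ : ℕ → μ × κ → Fin L) (v : κ ⊕ μ → ℝ) (k : ℕ) :
    (∀ j, (stateSeq (latticeStep R) 1 σ k).mulVec v (Sum.inl j)
      = R ^ (Fintype.card μ * k) * (v (Sum.inl j) + ∑ i, v (Sum.inr i) * truncatedMatrix σ k i j)) ∧
    ∀ i, (stateSeq (latticeStep R) 1 σ k).mulVec v (Sum.inr i)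
      = (R ^ (Fintype.card κ * k))⁻¹ * v (Sum.inr i) := by
  induction k with
  | zero => simp [stateSeq, truncatedMatrix]
  | succ k ih =>
    obtain ⟨ih1, ih2⟩ := ih
    constructor
    · intro j
      rw [stateSeq, latticeStep, ← Matrix.mulVec_mulVec, renorm_mulVec_inl, ih1]
      simp only [ih2]
      have h1 : ∀ i, truncatedMatrix σ (k + 1) i j = truncatedMatrix σ k i j
          + digitShift (σ k) i j * (((2 * L : ℕ) : ℝ) ^ k)⁻¹ := fun i => by
        simp [truncatedMatrix, Finset.sum_range_succ, digitShift, Function.curry]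
      have h2 : (R ^ (Fintype.card κ * k))⁻¹
          = R ^ (Fintype.card μ * k) * (((2 * L : ℕ) : ℝ) ^ k)⁻¹ := by
        rw [← hL, ← pow_mul, add_mul, pow_add]
        field_simp
      simp only [h1, mul_add, Finset.sum_add_distrib, h2]
      rw [pow_add, mul_one, Finset.mul_sum, Finset.mul_sum, Finset.mul_sum]
      have h3 : ∀ i, R ^ Fintype.card μ * (R ^ (Fintype.card μ * k) * (((2 * L : ℕ) : ℝ) ^ k)⁻¹
          * v (Sum.inr i) * digitShift (σ k) i j) = R ^ (Fintype.card μ * k) * R ^ Fintype.card μ *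
          (v (Sum.inr i) * (digitShift (σ k) i j * (((2 * L : ℕ) : ℝ) ^ k)⁻¹)) := fun i => by ring
      simp only [h3, ← Finset.mul_sum]
      ring
    · intro i
      rw [stateSeq, latticeStep, ← Matrix.mulVec_mulVec, renorm_mulVec_inr, ih2, mul_add, mul_one,
        pow_add, mul_inv]
      ring

/-- A nonzero vector of a thick lattice is not short. -/
lemma IsThick.exists_le_abs {ε : ℝ} {B : Matrix κ κ ℝ} (hB : IsThick ε B)
    (hd : 1 < Fintype.card κ) {v : κ → ℤ} (hv : v ≠ 0) :
    ∃ k, ε ^ (Fintype.card κ - 1) ≤ |B.mulVec (fun k => (v k : ℝ)) k| := by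
  have hne : Nonempty κ := Fintype.card_pos_iff.mp (by omega)
  have hind : ColIndep (Matrix.of fun k (_ : Fin 1) => v k) := by
    intro x hx
    obtain ⟨k, hk⟩ := Function.ne_iff.mp hv
    ext b
    have h1 := congrFun hx k
    simp only [Matrix.mulVec, dotProduct, Matrix.of_apply, Finset.univ_unique,
      Finset.sum_singleton, Pi.zero_apply, mul_eq_zero] at h1
    rw [Subsingleton.elim b default]
    exact h1.resolve_left hk
  have h1 := hB.2 1 one_pos hd _ hind
  obtain ⟨S, hS⟩ := exists_abs_det_eq_maxMinor
    (B * toRealMat (Matrix.of fun k (_ : Fin 1) => v k))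
  refine ⟨S 0, ?_⟩
  rw [← hS, one_mul, Matrix.det_unique] at h1
  exact h1

lemma one_le_norm_of_ne_zero {ι : Type*} [Fintype ι] {q : ι → ℤ} (hq : q ≠ 0) : 1 ≤ ‖q‖ := by
  obtain ⟨i, hi⟩ := Function.ne_iff.mp hq
  refine le_trans ?_ (norm_le_pi_norm q i)
  rw [Int.norm_eq_abs]
  exact_mod_cast Int.one_le_abs hi

/-- If the lattices along a trajectory stay thick, then the limit matrix is badly approximable. -/
theorem badlyApproximable_of_isThick [Nonempty κ] [Nonempty μ] {R : ℝ} (hR : 1 < R) {L : ℕ}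
    (hL : R ^ (Fintype.card κ + Fintype.card μ) = ((2 * L : ℕ) : ℝ)) {ε : ℝ} (hε : 0 < ε)
    (hε' : ε ≤ 1) (σ : ℕ → μ × κ → Fin L)
    (hσ : ∀ k, IsThick ε (stateSeq (latticeStep (κ := κ) (μ := μ) R) 1 σ k)) :
    ∃ C : ℝ, 0 < C ∧ ∀ (p : κ → ℤ) (q : μ → ℤ), q ≠ 0 → ∃ j,
      C * ‖q‖ ^ (-((Fintype.card μ : ℝ) / Fintype.card κ))
        ≤ |∑ i, (q i : ℝ) * limitMatrix σ i j + p j| := by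
  set M := Fintype.card μ with hM
  set n := Fintype.card κ with hn
  have hM0 : 0 < M := Fintype.card_pos
  have hn0 : 0 < n := Fintype.card_pos
  have hM1 : (1 : ℝ) ≤ M := by exact_mod_cast hM0
  have hn1 : (0 : ℝ) < n := by exact_mod_cast hn0
  have hR0 : 0 < R := one_pos.trans hR
  set δ := ε ^ (Fintype.card (κ ⊕ μ) - 1) with hδ
  have hδ0 : 0 < δ := pow_pos hε _
  have hδ1 : δ ≤ 1 := pow_le_one₀ hε.le hε'
  -- for `|q| < ρ Rⁿᵏ` the contracted coordinates are too short for a thick lattice, and the error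
  -- of the truncation after `k` digits is harmless
  set ρ := δ / (2 * M) with hρ
  have hρ0 : 0 < ρ := by positivity
  have hρδ : ρ < δ := by
    rw [hρ, div_lt_iff₀ (by positivity)]
    nlinarith
  have hMρ : M * ρ = δ / 2 := by
    rw [hρ]
    field_simp
  have hexp : -((M : ℝ) / n) ≤ 0 := neg_nonpos.mpr (by positivity)
  refine ⟨δ / 2 * (R ^ n / ρ) ^ (-((M : ℝ) / n)), by positivity, fun p q hq => ?_⟩
  have hq1 : 1 ≤ ‖q‖ := one_le_norm_of_ne_zero hq
  -- the scale `k` at which `q` becomes short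
  have hex : ∃ k : ℕ, ‖q‖ < ρ * R ^ (n * k) := by
    obtain ⟨k, hk⟩ := pow_unbounded_of_one_lt (‖q‖ / ρ) (one_lt_pow₀ hR hn0.ne')
    refine ⟨k, ?_⟩
    rw [div_lt_iff₀ hρ0, ← pow_mul] at hk
    linarith
  classical
  set k := Nat.find hex with hk
  have hk1 : ‖q‖ < ρ * R ^ (n * k) := Nat.find_spec hex
  have hk0 : k ≠ 0 := by
    intro h0
    rw [h0, mul_zero, pow_zero, mul_one] at hk1
    linarith
  obtain ⟨k', hk'⟩ := Nat.exists_eq_succ_of_ne_zero hk0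
  have hk2 : ρ * R ^ (n * k') ≤ ‖q‖ := not_lt.mp (Nat.find_min hex (by omega))
  have hqi : ∀ i, |(q i : ℝ)| ≤ ‖q‖ := fun i => by
    have := norm_le_pi_norm q i
    rwa [Int.norm_eq_abs] at this
  have hv : Sum.elim p q ≠ 0 := fun h => hq (funext fun i => congrFun h (Sum.inr i))
  have hcard : 1 < Fintype.card (κ ⊕ μ) := by
    rw [Fintype.card_sum]
    omega
  obtain ⟨c, hc⟩ := (hσ k).exists_le_abs hcard hv
  obtain ⟨e1, e2⟩ := stateSeq_latticeStep_mulVec hR0 hL σ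
    (fun c => ((Sum.elim p q c : ℤ) : ℝ)) k
  rcases c with j | i
  swap
  · exfalso
    rw [e2, abs_mul, abs_of_pos (inv_pos.mpr (pow_pos hR0 _))] at hc
    simp only [Sum.elim_inr] at hc
    have h1 : (R ^ (n * k))⁻¹ * |(q i : ℝ)| < δ := by
      rw [inv_mul_lt_iff₀ (pow_pos hR0 _)]
      have := hqi i
      have h2 : ρ * R ^ (n * k) < R ^ (n * k) * δ := by
        rw [mul_comm]
        exact mul_lt_mul_of_pos_left hρδ (pow_pos hR0 _)
      linarith
    linarith
  refine ⟨j, ?_⟩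
  rw [e1, abs_mul, abs_of_pos (pow_pos hR0 _)] at hc
  simp only [Sum.elim_inl, Sum.elim_inr] at hc
  have hRM : 0 < R ^ (M * k) := pow_pos hR0 _
  have htail : |∑ i, (q i : ℝ) * limitMatrix σ i j - ∑ i, (q i : ℝ) * truncatedMatrix σ k i j|
      ≤ δ / 2 * (R ^ (M * k))⁻¹ := by
    rw [← Finset.sum_sub_distrib]
    refine (Finset.abs_sum_le_sum_abs _ _).trans ?_
    have h1 : ∀ i ∈ Finset.univ, |(q i : ℝ) * limitMatrix σ i j - (q i : ℝ) * truncatedMatrix σ k i j|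
        ≤ ‖q‖ * (((2 * L : ℕ) : ℝ) ^ k)⁻¹ := by
      intro i _
      rw [← mul_sub, abs_mul]
      exact mul_le_mul (hqi i) (abs_limitMatrix_sub_truncatedMatrix_le σ k i j) (abs_nonneg _)
        (norm_nonneg _)
    refine (Finset.sum_le_card_nsmul _ _ _ h1).trans ?_
    rw [Finset.card_univ, nsmul_eq_mul, ← hL, ← hM, ← pow_mul]
    have h2 : (R ^ ((n + M) * k))⁻¹ = (R ^ (n * k))⁻¹ * (R ^ (M * k))⁻¹ := by
      rw [add_mul, pow_add, mul_inv]
    rw [h2]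
    have h3 : ‖q‖ * (R ^ (n * k))⁻¹ ≤ ρ := by
      rw [← div_eq_mul_inv, div_le_iff₀ (pow_pos hR0 _)]
      exact hk1.le
    calc (M : ℝ) * (‖q‖ * ((R ^ (n * k))⁻¹ * (R ^ (M * k))⁻¹))
        = M * (‖q‖ * (R ^ (n * k))⁻¹) * (R ^ (M * k))⁻¹ := by ring
      _ ≤ M * ρ * (R ^ (M * k))⁻¹ := by gcongr
      _ = δ / 2 * (R ^ (M * k))⁻¹ := by rw [hMρ]
  have hmain : δ / 2 * (R ^ (M * k))⁻¹ ≤ |∑ i, (q i : ℝ) * limitMatrix σ i j + p j| := by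
    have h1 : δ * (R ^ (M * k))⁻¹ ≤ |(p j : ℝ) + ∑ i, (q i : ℝ) * truncatedMatrix σ k i j| := by
      rw [← div_eq_mul_inv, div_le_iff₀ hRM, mul_comm]
      exact hc
    have h2 := abs_sub_abs_le_abs_sub
      ((p j : ℝ) + ∑ i, (q i : ℝ) * truncatedMatrix σ k i j)
      (∑ i, (q i : ℝ) * limitMatrix σ i j + p j)
    have h3 : (p j : ℝ) + ∑ i, (q i : ℝ) * truncatedMatrix σ k i j
        - (∑ i, (q i : ℝ) * limitMatrix σ i j + p j)
        = -(∑ i, (q i : ℝ) * limitMatrix σ i j - ∑ i, (q i : ℝ) * truncatedMatrix σ k i j) := by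
      ring
    rw [h3, abs_neg] at h2
    linarith
  refine le_trans ?_ hmain
  rw [mul_assoc, ← Real.mul_rpow (by positivity) (norm_nonneg _)]
  refine mul_le_mul_of_nonneg_left ?_ (by positivity)
  have h4 : (R ^ (M * k))⁻¹ = (R ^ (n * k)) ^ (-((M : ℝ) / n)) := by
    rw [← Real.rpow_natCast R (n * k), ← Real.rpow_mul hR0.le, ← Real.rpow_natCast R (M * k),
      ← Real.rpow_neg hR0.le]
    congr 1
    push_cast
    field_simp
  rw [h4]
  refine Real.rpow_le_rpow_of_nonpos (pow_pos hR0 _) ?_ hexp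
  rw [hk', Nat.succ_eq_add_one, mul_add, mul_one, pow_add, div_mul_eq_mul_div, le_div_iff₀ hρ0]
  calc R ^ (n * k') * R ^ n * ρ = R ^ n * (ρ * R ^ (n * k')) := by ring
    _ ≤ R ^ n * ‖q‖ := by gcongr

end Trajectory

/-! ### A change of variables for forms with few shifts -/

section BlockAct

variable {α ρ μ : Type*} [Fintype ρ]

/-- The row vector `v` times the square matrix whose rows are the unit vectors of `ℝ^α` followed
by the rows of `y`. -/
def blockAct (y : ρ → α ⊕ ρ → ℝ) (v : α ⊕ ρ → ℝ) (k : α ⊕ ρ) : ℝ :=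
  Sum.elim (fun a => v (Sum.inl a)) 0 k + ∑ j, v (Sum.inr j) * y j k

lemma blockAct_sub_blockAct (y y' : ρ → α ⊕ ρ → ℝ) (v v' : α ⊕ ρ → ℝ) (k : α ⊕ ρ) :
    blockAct y (v - v') k
      = (blockAct y v k - blockAct y' v' k) - ∑ j, v' (Sum.inr j) * (y j k - y' j k) := by
  simp only [blockAct, Pi.sub_apply, sub_mul, mul_sub, Finset.sum_sub_distrib]
  rcases k with a | j
  · simp
    ring
  · simp

/-- The matrix with rows `y` followed by the rows of `z` multiplied by the block matrix of `y`. -/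
def blockMatrix (y : ρ → α ⊕ ρ → ℝ) (z : μ → α ⊕ ρ → ℝ) : ρ ⊕ μ → α ⊕ ρ → ℝ :=
  Sum.elim y fun i => blockAct y (z i)

/-- The change of variables that reduces the forms `qX - p` with `p ∈ ℤ^α` to the classical forms
`q'' z - (p, -q')`. -/
lemma sum_mul_blockMatrix_sub [Fintype μ] (y : ρ → α ⊕ ρ → ℝ) (z : μ → α ⊕ ρ → ℝ) (p : α → ℤ)
    (q : ρ ⊕ μ → ℤ) (k : α ⊕ ρ) :
    ∑ a, (q a : ℝ) * blockMatrix y z a k - Sum.elim (fun a => (p a : ℝ)) 0 k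
      = blockAct y (fun l => ∑ i, (q (Sum.inr i) : ℝ) * z i l
          + ((Sum.elim (fun a => - p a) (fun j => q (Sum.inl j)) l : ℤ) : ℝ)) k := by
  have h1 : ∑ i, (q (Sum.inr i) : ℝ) * ∑ j, z i (Sum.inr j) * y j k
      = ∑ j, (∑ i, (q (Sum.inr i) : ℝ) * z i (Sum.inr j)) * y j k := by
    simp only [Finset.mul_sum, Finset.sum_mul]
    rw [Finset.sum_comm]
    exact Finset.sum_congr rfl fun j _ => Finset.sum_congr rfl fun i _ => by ring
  simp only [Fintype.sum_sum_type, blockMatrix, Sum.elim_inl, Sum.elim_inr, blockAct, mul_add,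
    Finset.sum_add_distrib, h1, add_mul]
  rcases k with a | j
  · simp
    ring
  · simp
    ring

/-- The rows of the identity matrix with index in `ρ`. -/
def unitRows (α ρ : Type*) [DecidableEq ρ] (j : ρ) : α ⊕ ρ → ℝ := Sum.elim 0 (Pi.single j 1)

variable [Fintype α] [DecidableEq ρ]

lemma abs_blockAct_sub_self_le {y : ρ → α ⊕ ρ → ℝ} {s : ℝ}
    (hy : ∀ j k, |y j k - unitRows α ρ j k| ≤ s) (v : α ⊕ ρ → ℝ) (k : α ⊕ ρ) :
    |blockAct y v k - v k| ≤ Fintype.card ρ * s * ‖v‖ := by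
  have h1 : blockAct y v k - v k = ∑ j, v (Sum.inr j) * (y j k - unitRows α ρ j k) := by
    have h2 : v k = Sum.elim (fun a => v (Sum.inl a)) 0 k
        + ∑ j, v (Sum.inr j) * unitRows α ρ j k := by
      rcases k with a | j
      · simp [unitRows]
      · simp [unitRows, Pi.single_apply]
    rw [h2, blockAct]
    simp only [mul_sub, Finset.sum_sub_distrib]
    ring
  rw [h1]
  refine (Finset.abs_sum_le_sum_abs _ _).trans ?_
  have h2 : ∀ j ∈ Finset.univ, |v (Sum.inr j) * (y j k - unitRows α ρ j k)| ≤ ‖v‖ * s := by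
    intro j _
    rw [abs_mul]
    exact mul_le_mul (norm_le_pi_norm v _) (hy j k) (abs_nonneg _) (norm_nonneg _)
  refine (Finset.sum_le_card_nsmul _ _ _ h2).trans_eq ?_
  rw [Finset.card_univ, nsmul_eq_mul]
  ring

/-- A block matrix close to the identity does not contract by more than the factor `2`. -/
lemma norm_le_two_mul_norm_blockAct {y : ρ → α ⊕ ρ → ℝ} {s : ℝ} (hs : Fintype.card ρ * s ≤ 1 / 2)
    (hy : ∀ j k, |y j k - unitRows α ρ j k| ≤ s) (v : α ⊕ ρ → ℝ) :
    ‖v‖ ≤ 2 * ‖blockAct y v‖ := by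
  have h1 : ‖v‖ ≤ ‖blockAct y v‖ + 1 / 2 * ‖v‖ := by
    refine (pi_norm_le_iff_of_nonneg (by positivity)).mpr fun k => ?_
    have h2 := abs_blockAct_sub_self_le hy v k
    have h3 : |blockAct y v k| ≤ ‖blockAct y v‖ := norm_le_pi_norm (blockAct y v) k
    have h4 := mul_le_mul_of_nonneg_right hs (norm_nonneg v)
    have h5 := abs_sub_abs_le_abs_sub (v k) (blockAct y v k)
    rw [abs_sub_comm] at h5
    rw [Real.norm_eq_abs]
    linarith
  linarith

end BlockAct

/-! ### A family of full dimension -/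

section Family

variable (α ρ μ : Type*) [Fintype α] [Fintype ρ] [Fintype μ]

/-- Matrices with entries in `[0, 2 |ρ| + 2]` for which the vectors `qX - (p, 0)`, with `p ∈ ℤ^α`
and `q ≠ 0`, are as large as Dirichlet's theorem permits, up to a constant. -/
def badFamily : Set (ρ ⊕ μ → α ⊕ ρ → ℝ) :=
  {X | (∀ a k, 0 ≤ X a k ∧ X a k ≤ 2 * Fintype.card ρ + 2) ∧
    ∃ C : ℝ, 0 < C ∧ ∀ (p : α → ℤ) (q : ρ ⊕ μ → ℤ), q ≠ 0 →
      C * ‖q‖ ^ (-((Fintype.card μ : ℝ) / Fintype.card (α ⊕ ρ)))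
        ≤ ‖fun k => ∑ a, (q a : ℝ) * X a k - Sum.elim (fun a => (p a : ℝ)) 0 k‖}

variable {α ρ μ}

lemma blockMatrix_mem_badFamily [DecidableEq ρ] {y : ρ → α ⊕ ρ → ℝ} {z : μ → α ⊕ ρ → ℝ} {s : ℝ}
    (hs : Fintype.card ρ * s ≤ 1 / 2) (hs1 : s ≤ 1)
    (hy : ∀ j k, unitRows α ρ j k ≤ y j k ∧ y j k ≤ unitRows α ρ j k + s)
    (hz : ∀ i k, 0 ≤ z i k ∧ z i k ≤ 1)
    (hbad : ∃ C : ℝ, 0 < C ∧ ∀ (p : α ⊕ ρ → ℤ) (q : μ → ℤ), q ≠ 0 → ∃ j,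
      C * ‖q‖ ^ (-((Fintype.card μ : ℝ) / Fintype.card (α ⊕ ρ)))
        ≤ |∑ i, (q i : ℝ) * z i j + p j|) :
    blockMatrix y z ∈ badFamily α ρ μ := by
  have hu : ∀ j k, 0 ≤ unitRows α ρ j k ∧ unitRows α ρ j k ≤ 1 := by
    rintro j (a | j')
    · simp [unitRows]
    · simp only [unitRows, Sum.elim_inr, Pi.single_apply]
      split_ifs <;> simp
  have hy2 : ∀ j k, 0 ≤ y j k ∧ y j k ≤ 2 := fun j k =>
    ⟨(hu j k).1.trans (hy j k).1, by linarith [(hy j k).2, (hu j k).2]⟩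
  refine ⟨?_, ?_⟩
  · rintro (j | i) k
    · simp only [blockMatrix, Sum.elim_inl]
      have h1 : (0 : ℝ) ≤ Fintype.card ρ := Nat.cast_nonneg _
      exact ⟨(hy2 j k).1, by linarith [(hy2 j k).2]⟩
    · simp only [blockMatrix, Sum.elim_inr, blockAct]
      have h1 : ∀ j, 0 ≤ z i (Sum.inr j) * y j k := fun j => mul_nonneg (hz i _).1 (hy2 j k).1
      have h2 : ∑ j, z i (Sum.inr j) * y j k ≤ 2 * Fintype.card ρ := by
        have : ∀ j ∈ Finset.univ, z i (Sum.inr j) * y j k ≤ 2 := fun j _ => by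
          nlinarith [hz i (Sum.inr j), hy2 j k]
        refine (Finset.sum_le_card_nsmul _ _ _ this).trans_eq ?_
        rw [Finset.card_univ, nsmul_eq_mul, mul_comm]
      have h3 : 0 ≤ Sum.elim (fun a => z i (Sum.inl a)) (0 : ρ → ℝ) k ∧
          Sum.elim (fun a => z i (Sum.inl a)) (0 : ρ → ℝ) k ≤ 1 := by
        rcases k with a | j
        · exact hz i _
        · simp
      exact ⟨add_nonneg h3.1 (Finset.sum_nonneg fun j _ => h1 j), by linarith⟩
  · obtain ⟨C, hC, hbad⟩ := hbad
    have hy' : ∀ j k, |y j k - unitRows α ρ j k| ≤ s := fun j k => by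
      rw [abs_le]
      constructor <;> linarith [hy j k]
    refine ⟨min C 1 / 2, by positivity, fun p q hq => ?_⟩
    simp only [sum_mul_blockMatrix_sub]
    set v : α ⊕ ρ → ℝ := fun l => ∑ i, (q (Sum.inr i) : ℝ) * z i l
          + ((Sum.elim (fun a => - p a) (fun j => q (Sum.inl j)) l : ℤ) : ℝ) with hv
    have h1 := norm_le_two_mul_norm_blockAct hs hy' v
    have hexp : -((Fintype.card μ : ℝ) / Fintype.card (α ⊕ ρ)) ≤ 0 :=
      neg_nonpos.mpr (by positivity)
    suffices h : min C 1 * ‖q‖ ^ (-((Fintype.card μ : ℝ) / Fintype.card (α ⊕ ρ))) ≤ ‖v‖ by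
      change _ ≤ ‖blockAct y v‖
      linarith
    have hq1 : 1 ≤ ‖q‖ := one_le_norm_of_ne_zero hq
    by_cases hq2 : (fun i => q (Sum.inr i)) = 0
    · obtain ⟨j, hj⟩ : ∃ j, q (Sum.inl j) ≠ 0 := by
        by_contra hcon
        push Not at hcon
        refine hq (funext fun a => ?_)
        rcases a with j | i
        · exact hcon j
        · exact congrFun hq2 i
      have h2 : v (Sum.inr j) = q (Sum.inl j) := by
        have : ∀ i, q (Sum.inr i) = 0 := fun i => congrFun hq2 i
        simp [hv, this]
      have h3 : 1 ≤ ‖v‖ := by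
        refine le_trans ?_ (norm_le_pi_norm v (Sum.inr j))
        rw [h2, Real.norm_eq_abs]
        exact_mod_cast Int.one_le_abs hj
      refine le_trans ?_ h3
      exact mul_le_one₀ (min_le_right _ _) (by positivity)
        (Real.rpow_le_one_of_one_le_of_nonpos hq1 hexp)
    · obtain ⟨l, hl⟩ := hbad (Sum.elim (fun a => - p a) fun j => q (Sum.inl j)) _ hq2
      have h2 : ‖fun i => q (Sum.inr i)‖ ≤ ‖q‖ :=
        (pi_norm_le_iff_of_nonneg (norm_nonneg _)).mpr fun i => norm_le_pi_norm q (Sum.inr i)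
      have h3 : 0 < ‖fun i => q (Sum.inr i)‖ := norm_pos_iff.mpr hq2
      refine le_trans ?_ (norm_le_pi_norm v l)
      rw [Real.norm_eq_abs]
      refine le_trans ?_ hl
      exact mul_le_mul (min_le_left _ _) (Real.rpow_le_rpow_of_nonpos h3 h2 hexp) (by positivity)
        hC.le

/-- The matrix of `badFamily` with prescribed digits. -/
noncomputable def familyPoint [DecidableEq ρ] {L : ℕ} (s : ℝ)
    (σ : ℕ → (ρ × (α ⊕ ρ) → Fin L) × (μ × (α ⊕ ρ) → Fin L)) : ρ ⊕ μ → α ⊕ ρ → ℝ :=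
  blockMatrix (fun j k => unitRows α ρ j k + s * limitMatrix (fun l => (σ l).1) j k)
    (limitMatrix fun l => (σ l).2)

/-- Matrices whose digits part at step `k` are far apart: if the digits of the rows `y` agree at that
step, then those of `z` differ, and the block matrix of `y` contracts at most by the factor `2`. -/
lemma familyPoint_separated [DecidableEq ρ] {L : ℕ} {s : ℝ} (hs : s = 1 / (2 * (Fintype.card ρ + 1)))
    {σ τ : ℕ → (ρ × (α ⊕ ρ) → Fin L) × (μ × (α ⊕ ρ) → Fin L)} {k : ℕ}
    (h : ∀ i < k, σ i = τ i) (hk : σ k ≠ τ k) :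
    s * (((2 * L : ℕ) : ℝ) ^ (k + 1))⁻¹ ≤ dist (familyPoint s σ) (familyPoint s τ) := by
  have hr : (0 : ℝ) ≤ Fintype.card ρ := Nat.cast_nonneg _
  have hs0 : 0 < s := by rw [hs]; positivity
  have hrs : Fintype.card ρ * s ≤ 1 / 2 := by
    rw [hs, mul_one_div, div_le_div_iff₀ (by positivity) two_pos]
    linarith
  have hs1 : 2 * (Fintype.card ρ + 1) * s = 1 := by
    rw [hs]
    field_simp
  set δ := (((2 * L : ℕ) : ℝ) ^ (k + 1))⁻¹ with hδ
  set D := dist (familyPoint s σ) (familyPoint s τ) with hD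
  have hent : ∀ a l, |familyPoint s σ a l - familyPoint s τ a l| ≤ D := by
    intro a l
    rw [← Real.dist_eq]
    exact (dist_le_pi_dist (familyPoint s σ a) (familyPoint s τ a) l).trans
      (dist_le_pi_dist (familyPoint s σ) (familyPoint s τ) a)
  have hyent : ∀ j l, s * |limitMatrix (fun l => (σ l).1) j l - limitMatrix (fun l => (τ l).1) j l|
      ≤ D := by
    intro j l
    refine le_trans (le_of_eq ?_) (hent (Sum.inl j) l)
    simp only [familyPoint, blockMatrix, Sum.elim_inl]
    rw [add_sub_add_left_eq_sub, ← mul_sub, abs_mul, abs_of_pos hs0]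
  by_cases h1 : (σ k).1 = (τ k).1
  · have h2 : (σ k).2 ≠ (τ k).2 := fun h2 => hk (Prod.ext h1 h2)
    obtain ⟨⟨i, l⟩, hil⟩ := Function.ne_iff.mp h2
    have h3 : δ ≤ |limitMatrix (fun l => (σ l).2) i l - limitMatrix (fun l => (τ l).2) i l| :=
      evenDigits_separated (fun i' hi' => by simp only [h i' hi']) hil
    set y : ρ → α ⊕ ρ → ℝ := fun j k => unitRows α ρ j k + s * limitMatrix (fun l => (σ l).1) j k
      with hy
    set y' : ρ → α ⊕ ρ → ℝ := fun j k => unitRows α ρ j k + s * limitMatrix (fun l => (τ l).1) j k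
      with hy'
    set z := limitMatrix (fun l => (σ l).2) i with hz
    set z' := limitMatrix (fun l => (τ l).2) i with hz'
    have hyu : ∀ j l, |y j l - unitRows α ρ j l| ≤ s := by
      intro j l
      rw [hy]
      simp only [add_sub_cancel_left]
      rw [abs_of_nonneg (mul_nonneg hs0.le (limitMatrix_nonneg _ _ _))]
      exact mul_le_of_le_one_right hs0.le (limitMatrix_le_one _ _ _)
    have h4 : ‖blockAct y (z - z')‖ ≤ D + Fintype.card ρ * D := by
      have hD0 : 0 ≤ D := dist_nonneg
      refine (pi_norm_le_iff_of_nonneg (by positivity)).mpr fun l' => ?_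
      rw [Real.norm_eq_abs, blockAct_sub_blockAct y y']
      refine (abs_sub _ _).trans (add_le_add (hent (Sum.inr i) l') ?_)
      refine (Finset.abs_sum_le_sum_abs _ _).trans ?_
      have : ∀ j ∈ Finset.univ, |z' (Sum.inr j) * (y j l' - y' j l')| ≤ D := by
        intro j _
        rw [abs_mul]
        have h5 : |z' (Sum.inr j)| ≤ 1 := by
          rw [abs_of_nonneg (limitMatrix_nonneg _ _ _)]
          exact limitMatrix_le_one _ _ _
        have h6 : |y j l' - y' j l'| ≤ D := hent (Sum.inl j) l'
        calc |z' (Sum.inr j)| * |y j l' - y' j l'| ≤ 1 * D :=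
              mul_le_mul h5 h6 (abs_nonneg _) zero_le_one
          _ = D := one_mul D
      refine (Finset.sum_le_card_nsmul _ _ _ this).trans_eq ?_
      rw [Finset.card_univ, nsmul_eq_mul]
    have h5 := norm_le_two_mul_norm_blockAct hrs hyu (z - z')
    have h6 : |z l - z' l| ≤ ‖z - z'‖ := norm_le_pi_norm (z - z') l
    have h7 : δ ≤ 2 * (Fintype.card ρ + 1) * D := by linarith
    calc s * δ ≤ s * (2 * (Fintype.card ρ + 1) * D) := mul_le_mul_of_nonneg_left h7 hs0.le
      _ = (2 * (Fintype.card ρ + 1) * s) * D := by ring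
      _ = D := by rw [hs1, one_mul]
  · obtain ⟨⟨j, l⟩, hjl⟩ := Function.ne_iff.mp h1
    have h3 : δ ≤ |limitMatrix (fun l => (σ l).1) j l - limitMatrix (fun l => (τ l).1) j l| :=
      evenDigits_separated (fun i' hi' => by simp only [h i' hi']) hjl
    exact (mul_le_mul_of_nonneg_left h3 hs0.le).trans (hyent j l)

lemma stateSeq_snd {St H K : Type*} (step : St → H → St) (s₀ : St) (σ : ℕ → K × H) (k : ℕ) :
    stateSeq (fun s (h : K × H) => step s h.2) s₀ σ k
      = stateSeq step s₀ (fun l => (σ l).2) k := by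
  induction k with
  | zero => rfl
  | succ k ih => rw [stateSeq, stateSeq, ih]

/-- The lower bound for the dimension obtained from the expansion in base `2 ^ (e d)`. -/
lemma le_dimH_badFamily_of_scale [DecidableEq α] [DecidableEq ρ] [DecidableEq μ]
    [Nonempty (α ⊕ ρ)] [Nonempty μ] {e d D : ℕ}
    (hd : d = Fintype.card (α ⊕ ρ) + Fintype.card μ)
    (hD : D = Fintype.card (ρ ⊕ μ) * Fintype.card (α ⊕ ρ)) {ε : ℝ} (he : 0 < e) (hε : 0 < ε)
    (hε' : ε ≤ 1) (heD : 1 < (e * d - 1) * D - 1)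
    (hgood : ∀ B : Matrix ((α ⊕ ρ) ⊕ μ) ((α ⊕ ρ) ⊕ μ) ℝ, IsThick ε B →
      (2 ^ (e * d - 1)) ^ Fintype.card (μ × (α ⊕ ρ)) ≤ 2 * Nat.card {t : μ × (α ⊕ ρ) →
        Fin (2 ^ (e * d - 1)) // IsThick ε (renorm (2 ^ e) (digitShift t) * B)}) :
    (Real.toNNReal ((((e * d - 1) * D - 1 : ℕ) : ℝ) / ((e * d : ℕ) : ℝ)) : ENNReal)
      ≤ dimH (badFamily α ρ μ) := by
  have hd0 : 0 < d := by
    have := Fintype.card_pos (α := μ)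
    omega
  have hed : 0 < e * d := Nat.mul_pos he hd0
  set L : ℕ := 2 ^ (e * d - 1) with hL
  have h2L : 2 * L = 2 ^ (e * d) := by
    rw [hL, ← pow_succ']
    congr 1
    omega
  have hRL : (2 ^ e : ℝ) ^ (Fintype.card (α ⊕ ρ) + Fintype.card μ) = ((2 * L : ℕ) : ℝ) := by
    rw [h2L, ← hd, ← pow_mul]
    push_cast
    rfl
  set s : ℝ := 1 / (2 * (Fintype.card ρ + 1)) with hs
  have hs0 : 0 < s := by positivity
  let step : Matrix ((α ⊕ ρ) ⊕ μ) ((α ⊕ ρ) ⊕ μ) ℝ →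
      (ρ × (α ⊕ ρ) → Fin L) × (μ × (α ⊕ ρ) → Fin L) → Matrix ((α ⊕ ρ) ⊕ μ) ((α ⊕ ρ) ⊕ μ) ℝ :=
    fun B h => latticeStep (2 ^ e) B h.2
  have hbL : (0 : ℝ) < ((2 * L : ℕ) : ℝ) := by
    rw [h2L]
    positivity
  have hdim := le_dimH_of_tree step (IsThick ε) (s₀ := 1) (isThick_one hε.le hε')
    (m := 2 ^ ((e * d - 1) * D - 1)) (b := 2 * L) (Nat.one_lt_two_pow (by omega))
    (by rw [h2L]; positivity) (fun B hB => ?_) (familyPoint s) (c := s * ((2 * L : ℕ) : ℝ)⁻¹)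
    (mul_pos hs0 (inv_pos.mpr hbL))
    (fun σ τ k h hk => ?_) (s := Real.toNNReal ((((e * d - 1) * D - 1 : ℕ) : ℝ) / ((e * d : ℕ) : ℝ)))
    ?_ ?_
  · refine hdim.trans (dimH_mono ?_)
    rintro _ ⟨σ, hσ, rfl⟩
    have hσ' : ∀ k, IsThick ε (stateSeq (latticeStep (κ := α ⊕ ρ) (μ := μ) (2 ^ e)) 1
        (fun l => (σ l).2) k) := fun k => by
      rw [← stateSeq_snd]
      exact hσ k
    refine blockMatrix_mem_badFamily (s := s) ?_ ?_ (fun j k => ⟨?_, ?_⟩) (fun i k => ?_)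
      (badlyApproximable_of_isThick (one_lt_pow₀ one_lt_two he.ne') hRL hε hε' _ hσ')
    · rw [hs, mul_one_div, div_le_div_iff₀ (by positivity) two_pos]
      linarith
    · rw [hs, div_le_one (by positivity)]
      have : (0 : ℝ) ≤ Fintype.card ρ := Nat.cast_nonneg _
      linarith
    · exact le_add_of_nonneg_right (mul_nonneg hs0.le (limitMatrix_nonneg _ _ _))
    · exact add_le_add_right (mul_le_of_le_one_right hs0.le (limitMatrix_le_one _ _ _)) _
    · exact ⟨limitMatrix_nonneg _ _ _, limitMatrix_le_one _ _ _⟩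
  · -- the digits of the first rows are free
    have h1 : Nat.card {h : (ρ × (α ⊕ ρ) → Fin L) × (μ × (α ⊕ ρ) → Fin L) // IsThick ε (step B h)}
        = L ^ Fintype.card (ρ × (α ⊕ ρ)) * Nat.card {t : μ × (α ⊕ ρ) → Fin L //
          IsThick ε (renorm (2 ^ e) (digitShift t) * B)} := by
      have eqv : {h : (ρ × (α ⊕ ρ) → Fin L) × (μ × (α ⊕ ρ) → Fin L) // IsThick ε (step B h)}
          ≃ (ρ × (α ⊕ ρ) → Fin L) × {t : μ × (α ⊕ ρ) → Fin L //
            IsThick ε (renorm (2 ^ e) (digitShift t) * B)} :=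
        { toFun := fun h => (h.1.1, ⟨h.1.2, h.2⟩)
          invFun := fun h => ⟨(h.1, h.2.1), h.2.2⟩
          left_inv := fun _ => rfl
          right_inv := fun _ => rfl }
      rw [Nat.card_congr eqv, Nat.card_prod]
      congr 1
      simp
    rw [h1]
    have h2 := Nat.mul_le_mul_left (L ^ Fintype.card (ρ × (α ⊕ ρ))) (hgood B hB)
    have h3 : L ^ Fintype.card (ρ × (α ⊕ ρ)) * L ^ Fintype.card (μ × (α ⊕ ρ))
        = 2 * 2 ^ ((e * d - 1) * D - 1) := by
      rw [← pow_add, ← pow_succ', hL, ← pow_mul, hD]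
      congr 1
      have : Fintype.card (ρ × (α ⊕ ρ)) + Fintype.card (μ × (α ⊕ ρ))
          = Fintype.card (ρ ⊕ μ) * Fintype.card (α ⊕ ρ) := by
        simp only [Fintype.card_prod, Fintype.card_sum]
        ring
      rw [this, ← hD]
      omega
    have h4 : 2 * 2 ^ ((e * d - 1) * D - 1) ≤ 2 * (L ^ Fintype.card (ρ × (α ⊕ ρ)) *
        Nat.card {t : μ × (α ⊕ ρ) → Fin L // IsThick ε (renorm (2 ^ e) (digitShift t) * B)}) := by
      rw [← h3]
      refine h2.trans_eq ?_
      ring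
    exact Nat.le_of_mul_le_mul_left h4 two_pos
  · have := familyPoint_separated hs h hk
    refine le_trans (le_of_eq ?_) this
    rw [pow_succ, mul_inv]
    ring
  · rw [Real.toNNReal_pos]
    have : 0 < (e * d - 1) * D - 1 := by omega
    positivity
  · rw [Real.coe_toNNReal _ (by positivity), h2L, Nat.cast_pow, Nat.cast_ofNat,
      ← Real.rpow_natCast 2 (e * d), ← Real.rpow_mul two_pos.le,
      mul_div_cancel₀ _ (by positivity), Real.rpow_natCast]
    push_cast
    exact le_rfl

/-- The family has full dimension: the factors `2` lost by the use of even digits and of half of the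
choices become negligible as the base `2 ^ (e d)` tends to infinity. -/
theorem le_dimH_badFamily [DecidableEq α] [DecidableEq ρ] [DecidableEq μ]
    [Nonempty (α ⊕ ρ)] [Nonempty μ] :
    ((Fintype.card (ρ ⊕ μ) * Fintype.card (α ⊕ ρ) : ℕ) : ENNReal) ≤ dimH (badFamily α ρ μ) := by
  set d := Fintype.card (α ⊕ ρ) + Fintype.card μ with hd
  set D := Fintype.card (ρ ⊕ μ) * Fintype.card (α ⊕ ρ) with hD
  have hn0 : 0 < Fintype.card (α ⊕ ρ) := Fintype.card_pos
  have hM0 : 0 < Fintype.card μ := Fintype.card_pos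
  have hd2 : 2 ≤ d := by omega
  have hD0 : 0 < D := by
    refine Nat.mul_pos ?_ hn0
    rw [Fintype.card_sum]
    omega
  obtain ⟨R₀, hR₀⟩ := exists_isThick_half (κ := α ⊕ ρ) (μ := μ)
  have hev : ∀ᶠ e : ℕ in Filter.atTop,
      (Real.toNNReal ((((e * d - 1) * D - 1 : ℕ) : ℝ) / ((e * d : ℕ) : ℝ)) : ENNReal)
        ≤ dimH (badFamily α ρ μ) := by
    obtain ⟨N, hN⟩ := pow_unbounded_of_one_lt R₀ one_lt_two
    filter_upwards [Filter.eventually_ge_atTop N, Filter.eventually_ge_atTop 3,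
      Filter.eventually_ge_atTop
        (4 * Fintype.card ((α ⊕ ρ) ⊕ μ) * Fintype.card (μ × (α ⊕ ρ)) + 1)] with e he1 he2 he3
    have hed : 2 * e ≤ e * d := by nlinarith
    obtain ⟨ε, hε, hε', hgood⟩ := hR₀ (2 ^ e)
      (hN.le.trans (pow_le_pow_right₀ one_le_two he1)) (one_le_pow₀ one_le_two)
      (2 ^ (e * d - 1)) (by
        have : e * d - 1 < 2 ^ (e * d - 1) := Nat.lt_two_pow_self
        omega)
    refine le_dimH_badFamily_of_scale hd hD (by omega) hε hε' ?_ hgood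
    have : (e * d - 1) * 1 ≤ (e * d - 1) * D := Nat.mul_le_mul_left _ hD0
    omega
  have hlim : Filter.Tendsto (fun e : ℕ =>
      (Real.toNNReal ((((e * d - 1) * D - 1 : ℕ) : ℝ) / ((e * d : ℕ) : ℝ)) : ENNReal))
      Filter.atTop (nhds ((Real.toNNReal (D : ℝ) : NNReal) : ENNReal)) := by
    refine ENNReal.tendsto_coe.mpr (tendsto_real_toNNReal ?_)
    have h1 : Filter.Tendsto (fun e : ℕ => (D : ℝ) - (D + 1) / d * (1 / (e : ℝ))) Filter.atTop
        (nhds ((D : ℝ) - (D + 1) / d * 0)) :=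
      tendsto_const_nhds.sub (tendsto_one_div_atTop_nhds_zero_nat.const_mul _)
    rw [mul_zero, sub_zero] at h1
    refine h1.congr' ?_
    filter_upwards [Filter.eventually_ge_atTop 1] with e he
    have hed : 2 ≤ e * d := by nlinarith
    have h2 : 1 ≤ (e * d - 1) * D := Nat.mul_pos (by omega) hD0
    have he0 : (e : ℝ) ≠ 0 := by positivity
    have hd0 : (d : ℝ) ≠ 0 := by positivity
    rw [Nat.cast_sub h2, Nat.cast_mul (e * d - 1), Nat.cast_sub (by omega)]
    push_cast
    field_simp
    ring
  have h := le_of_tendsto hlim hev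
  simpa using h

end Family

/-! ### Coordinates adapted to the lattice -/

section Coordinates

lemma mulVec_eq_sum_smul {κ ι : Type*} [Fintype ι] (v : ι → κ → ℤ) (x : ι → ℤ) :
    (Matrix.of fun j c => v c j).mulVec x = ∑ c, x c • v c := by
  ext j
  rw [Finset.sum_apply]
  exact Finset.sum_congr rfl fun c _ => mul_comm _ _

/-- Linear coordinates on `ℝⁿ` in which the lattice `A` consists of integer vectors supported on
the first `latticeDim A` coordinates. -/
lemma exists_latticeCoordinates {n : ℕ} (A : AddSubgroup (Fin n → ℤ)) :
    ∃ (r : ℕ) (S : (Fin n → ℝ) ≃ₗ[ℝ] (Fin (latticeDim A) ⊕ Fin r → ℝ)), latticeDim A + r = n ∧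
      ∀ p ∈ A, ∃ z : Fin (latticeDim A) → ℤ,
        S (fun j => (p j : ℝ)) = Sum.elim (fun c => (z c : ℝ)) 0 := by
  set N : Submodule ℤ (Fin n → ℤ) := A.toIntSubmodule with hN
  have a := Module.finBasis ℤ N
  set k := Module.finrank ℤ N with hk
  set w : Matrix (Fin n) (Fin k) ℤ := Matrix.of fun j c => (a c : Fin n → ℤ) j with hw
  have hwx : ∀ x : Fin k → ℤ, w.mulVec x = ((∑ c, x c • a c : N) : Fin n → ℤ) := by
    intro x
    rw [AddSubmonoidClass.coe_finsetSum]
    exact mulVec_eq_sum_smul (fun c => (a c : Fin n → ℤ)) x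
  have hind : ColIndep w := by
    intro x hx
    rw [hwx] at hx
    exact funext (Fintype.linearIndependent_iff.mp a.linearIndependent x (Subtype.ext hx))
  have hli : LinearIndependent ℝ (toRealMat w).col := by
    rw [Fintype.linearIndependent_iff]
    intro g hg
    by_contra hcon
    push Not at hcon
    obtain ⟨c, hc⟩ := hcon
    refine hind.maxMinor_pos.ne' (maxMinor_eq_zero_of_mulVec (x := g) (fun h => hc (congrFun h c)) ?_)
    rw [← hg]
    ext j
    simp [Matrix.mulVec, dotProduct, mul_comm]
  have hmem : ∀ p ∈ A, ∃ z : Fin k → ℤ, (fun j => (p j : ℝ)) = ∑ c, (z c : ℝ) • (toRealMat w).col c := by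
    intro p hp
    refine ⟨a.repr ⟨p, hp⟩, ?_⟩
    have h1 := hwx (a.repr ⟨p, hp⟩)
    rw [a.sum_repr] at h1
    ext j
    have h2 : (p j : ℤ) = w.mulVec (a.repr ⟨p, hp⟩) j := by rw [h1]
    rw [h2, ← congrFun (toRealMat_mulVec w _) j, Finset.sum_apply]
    simp only [Matrix.mulVec, dotProduct]
    refine Finset.sum_congr rfl fun c _ => ?_
    rw [Pi.smul_apply, smul_eq_mul, mul_comm]
    rfl
  have hspan : Submodule.span ℝ ((fun (v : Fin n → ℤ) (j : Fin n) => (v j : ℝ)) '' (A : Set (Fin n → ℤ)))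
      = Submodule.span ℝ (Set.range (toRealMat w).col) := by
    refine le_antisymm (Submodule.span_le.mpr ?_) (Submodule.span_mono ?_)
    · rintro _ ⟨p, hp, rfl⟩
      obtain ⟨z, hz⟩ := hmem p hp
      simp only [hz]
      exact Submodule.sum_mem _ fun c _ =>
        Submodule.smul_mem _ _ (Submodule.subset_span ⟨c, rfl⟩)
    · rintro _ ⟨c, rfl⟩
      exact ⟨a c, (a c).2, rfl⟩
  have hdim : latticeDim A = k := by
    rw [latticeDim, hspan, finrank_span_eq_card hli, Fintype.card_fin]
  rw [hdim]
  have bQ := Module.finBasis ℝ ((Fin n → ℝ) ⧸ Submodule.span ℝ (Set.range (toRealMat w).col))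
  let b := (Module.Basis.span hli).sumQuot bQ
  refine ⟨_, b.equivFun, ?_, fun p hp => ?_⟩
  · have h1 := Module.finrank_eq_card_basis b
    simp only [Module.finrank_fintype_fun_eq_card, Fintype.card_sum, Fintype.card_fin] at h1
    omega
  · obtain ⟨z, hz⟩ := hmem p hp
    refine ⟨z, ?_⟩
    have hb : ∀ c, b (Sum.inl c) = (toRealMat w).col c := fun c => by
      rw [Module.Basis.sumQuot_inl, Module.Basis.span_apply]
    rw [hz]
    simp only [← hb]
    rw [map_sum]
    ext l
    rw [Finset.sum_apply]
    rcases l with c | c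
    · simp [Finsupp.single_apply]
    · simp

lemma linForms_eq {m n : ℕ} (X : Fin m → Fin n → ℝ) (p : Fin n → ℤ) (q : Fin m → ℤ) :
    linForms X p q = ∑ i, (q i : ℝ) • X i - fun j => (p j : ℝ) := by
  unfold linForms
  congr 1
  ext j
  simp [Matrix.vecMul, dotProduct]

lemma exists_pos_norm_le {V W : Type*} [NormedAddCommGroup V] [NormedSpace ℝ V]
    [FiniteDimensional ℝ V] [NormedAddCommGroup W] [NormedSpace ℝ W] (S : V →ₗ[ℝ] W) :
    ∃ K : ℝ, 0 < K ∧ ∀ v, ‖S v‖ ≤ K * ‖v‖ := by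
  refine ⟨‖LinearMap.toContinuousLinearMap S‖ + 1, by positivity, fun v => ?_⟩
  have h1 := (LinearMap.toContinuousLinearMap S).le_opNorm v
  have h2 : (LinearMap.toContinuousLinearMap S) v = S v := rfl
  rw [h2] at h1
  nlinarith [norm_nonneg v]

end Coordinates

/-! ### Dimension and volume of sets of matrices -/

section Dimension

variable {m n : ℕ}

lemma finrank_matrices : Module.finrank ℝ (Fin m → Fin n → ℝ) = m * n := by
  rw [Module.finrank_pi_fintype]
  simp

lemma dimH_matrices_le (s : Set (Fin m → Fin n → ℝ)) : dimH s ≤ ((m * n : ℕ) : ENNReal) := by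
  refine (dimH_mono (Set.subset_univ s)).trans_eq ?_
  rw [Real.dimH_univ_eq_finrank, finrank_matrices]

lemma le_dimH_of_volume_ne_zero {s : Set (Fin m → Fin n → ℝ)} (hs : volume s ≠ 0) :
    ((m * n : ℕ) : ENNReal) ≤ dimH s := by
  by_contra hcon
  push Not at hcon
  refine hs ?_
  have h1 : volume ≪ (Measure.hausdorffMeasure ((m * n : ℕ) : ℝ) :
      Measure (Fin m → Fin n → ℝ)) := by
    rw [← finrank_matrices]
    exact Measure.absolutelyContinuous_isAddHaarMeasure _ _
  refine measure_zero_of_dimH_lt (d := ((m * n : ℕ) : NNReal)) ?_ (by simpa using hcon)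
  simpa using h1

end Dimension

/-! ### Almost every matrix when the span is small -/

section FewForms

variable {m n : ℕ}

/-- If `m + u ≤ n`, then for almost every `X` the map `q ↦ qX` is injective modulo the span of the
lattice, so that `qX - p` is bounded below by a multiple of `q`. -/
lemma ae_exists_mul_norm_lt (A : AddSubgroup (Fin n → ℤ)) (hA : m + latticeDim A ≤ n) :
    ∀ᵐ X ∂(volume : Measure (Fin m → Fin n → ℝ)),
      ∃ C : ℝ, 0 < C ∧ ∀ p ∈ A, ∀ q : Fin m → ℤ, q ≠ 0 → C * ‖q‖ < ‖linForms X p q‖ := by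
  obtain ⟨r, S, hr, hS⟩ := exists_latticeCoordinates A
  have hmr : m ≤ r := by omega
  let D : (Fin m → Fin n → ℝ) → Matrix (Fin m) (Fin m) ℝ := fun X =>
    Matrix.of fun i j => S (X i) (Sum.inr (Fin.castLE hmr j))
  have hSc : Continuous S := S.toLinearMap.continuous_of_finiteDimensional
  have hDc : Continuous D := by
    refine continuous_matrix fun i j => ?_
    change Continuous fun X : Fin m → Fin n → ℝ => S (X i) (Sum.inr (Fin.castLE hmr j))
    exact (continuous_apply (Sum.inr (Fin.castLE hmr j))).comp (hSc.comp (continuous_apply i))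
  have hae : ∀ᵐ X ∂(volume : Measure (Fin m → Fin n → ℝ)), X ∈ {X | (D X).det ≠ 0} := by
    -- along a suitable direction the determinant is a monic polynomial, which has few zeros
    let X₀ : Fin m → Fin n → ℝ := fun i => S.symm (Pi.single (Sum.inr (Fin.castLE hmr i)) 1)
    have hD₀ : ∀ X (t : ℝ), D (X + t • X₀) = D X + t • (1 : Matrix (Fin m) (Fin m) ℝ) := by
      intro X t
      ext i j
      have h1 : (Pi.single (Sum.inr (Fin.castLE hmr i)) 1 : Fin (latticeDim A) ⊕ Fin r → ℝ)
          (Sum.inr (Fin.castLE hmr j)) = (1 : Matrix (Fin m) (Fin m) ℝ) i j := by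
        rw [Pi.single_apply, Matrix.one_apply]
        refine if_congr ?_ rfl rfl
        rw [Sum.inr.injEq, (Fin.castLE_injective hmr).eq_iff, eq_comm]
      simp [D, X₀, ← h1]
    refine ae_mem_of_ae_add_linearMap_mem (LinearMap.toSpanSingleton ℝ _ X₀) volume volume
      (isOpen_ne_fun hDc.matrix_det continuous_const).measurableSet fun X => ?_
    have hfin : Set.Finite {t : ℝ | (D X + t • (1 : Matrix (Fin m) (Fin m) ℝ)).det = 0} := by
      refine ((-D X).charpoly.rootSet_finite ℝ).subset fun t ht => ?_
      rw [Polynomial.mem_rootSet]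
      refine ⟨(Matrix.charpoly_monic _).ne_zero, ?_⟩
      rw [Polynomial.coe_aeval_eq_eval, Matrix.eval_charpoly, sub_neg_eq_add, add_comm]
      rw [Matrix.scalar_apply, ← Matrix.smul_one_eq_diagonal]
      exact ht
    have hnull := hfin.measure_zero (volume : Measure ℝ)
    rw [ae_iff]
    refine measure_mono_null (fun t ht => ?_) hnull
    simp only [Set.mem_ofPred_eq, not_not, LinearMap.toSpanSingleton_apply] at ht
    rw [hD₀] at ht
    exact ht
  filter_upwards [hae] with X hX
  obtain ⟨K, hK, hSK⟩ := exists_pos_norm_le S.toLinearMap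
  have hu : IsUnit (D X).det := isUnit_iff_ne_zero.mpr hX
  obtain ⟨K', hK', hinv⟩ := exists_pos_norm_le (Matrix.vecMulLinear (D X)⁻¹)
  refine ⟨1 / (2 * K' * K), by positivity, fun p hp q hq => ?_⟩
  obtain ⟨z, hz⟩ := hS p hp
  have h1 : ‖fun i => (q i : ℝ)‖ ≤ K' * ‖Matrix.vecMul (fun i => (q i : ℝ)) (D X)‖ := by
    have := hinv (Matrix.vecMul (fun i => (q i : ℝ)) (D X))
    rwa [Matrix.vecMulLinear_apply, Matrix.vecMul_vecMul, Matrix.mul_nonsing_inv _ hu,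
      Matrix.vecMul_one] at this
  have h2 : ‖Matrix.vecMul (fun i => (q i : ℝ)) (D X)‖ ≤ ‖S (linForms X p q)‖ := by
    refine (pi_norm_le_iff_of_nonneg (norm_nonneg _)).mpr fun j => ?_
    refine le_trans (le_of_eq ?_) (norm_le_pi_norm _ (Sum.inr (Fin.castLE hmr j)))
    congr 1
    rw [linForms_eq, map_sub, hz, map_sum]
    simp [D, Matrix.vecMul, dotProduct]
  have h3 := hSK (linForms X p q)
  have h4 : ‖fun i => (q i : ℝ)‖ = ‖q‖ := rfl
  have h5 : 0 < ‖q‖ := norm_pos_iff.mpr hq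
  have h6 : ‖q‖ ≤ K' * K * ‖linForms X p q‖ := by
    rw [← h4, mul_assoc]
    exact h1.trans (mul_le_mul_of_nonneg_left (h2.trans h3) hK'.le)
  rw [one_div_mul_eq_div, div_lt_iff₀ (by positivity)]
  nlinarith

lemma ae_mem_BadA (A : AddSubgroup (Fin n → ℤ)) (hA : m + latticeDim A ≤ n) :
    ∀ᵐ X ∂(volume : Measure (Fin m → Fin n → ℝ)), X ∈ BadA m n A := by
  filter_upwards [ae_exists_mul_norm_lt A hA] with X hX
  obtain ⟨C, hC, h⟩ := hX
  refine ⟨C, hC, fun p hp q hq => lt_of_le_of_lt ?_ (h p hp q hq)⟩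
  refine mul_le_mul_of_nonneg_left ?_ hC.le
  refine (Real.rpow_le_rpow_of_exponent_le (one_le_norm_of_ne_zero hq) ?_).trans_eq
    (Real.rpow_one _)
  have : 0 ≤ ((m : ℝ) + (latticeDim A : ℝ)) / (n : ℝ) := by positivity
  linarith

end FewForms

/-! ### The dimension of the badly approximable matrices -/

section ManyForms

variable {m n : ℕ}

/-- If `m + u > n`, a linear change of variables maps `badFamily` into `BadA`, and it preserves
dimension. -/
lemma le_dimH_BadA_of_lt (A : AddSubgroup (Fin n → ℤ)) (hn : 0 < n) (hA : n < m + latticeDim A) :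
    ((m * n : ℕ) : ENNReal) ≤ dimH (BadA m n A) := by
  obtain ⟨r, S, hr, hS⟩ := exists_latticeCoordinates A
  obtain ⟨M, rfl⟩ : ∃ M, m = r + M := Nat.exists_eq_add_of_le (by omega)
  have hM : 0 < M := by omega
  have : Nonempty (Fin (latticeDim A) ⊕ Fin r) := by
    rw [← Fintype.card_pos_iff, Fintype.card_sum, Fintype.card_fin, Fintype.card_fin]
    omega
  have : Nonempty (Fin M) := ⟨⟨0, hM⟩⟩
  have hdim := le_dimH_badFamily (α := Fin (latticeDim A)) (ρ := Fin r) (μ := Fin M)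
  let e : Fin r ⊕ Fin M ≃ Fin (r + M) := finSumFinEquiv
  let Ξ : (Fin r ⊕ Fin M → Fin (latticeDim A) ⊕ Fin r → ℝ) ≃ₗ[ℝ] (Fin (r + M) → Fin n → ℝ) :=
    (LinearEquiv.piCongrRight fun _ => S.symm).trans (LinearEquiv.funCongrLeft ℝ _ e.symm)
  have hΞ : ∀ Y i, Ξ Y i = S.symm (Y (e.symm i)) := fun _ _ => rfl
  rw [← Ξ.toContinuousLinearEquiv.dimH_image] at hdim
  simp only [Fintype.card_sum, Fintype.card_fin] at hdim
  rw [hr] at hdim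
  refine hdim.trans (dimH_mono ?_)
  rintro _ ⟨Y, ⟨-, C, hC, hY⟩, rfl⟩
  obtain ⟨K, hK, hSK⟩ := exists_pos_norm_le S.toLinearMap
  refine ⟨C / (2 * K), by positivity, fun p hp q hq => ?_⟩
  obtain ⟨z, hz⟩ := hS p hp
  have hq' : (fun a => q (e a)) ≠ 0 := by
    intro h
    refine hq (funext fun i => ?_)
    have := congrFun h (e.symm i)
    simpa using this
  have hnorm : ‖fun a => q (e a)‖ = ‖q‖ := by
    refine le_antisymm ?_ ?_
    · exact (pi_norm_le_iff_of_nonneg (norm_nonneg _)).mpr fun a => norm_le_pi_norm q (e a)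
    · refine (pi_norm_le_iff_of_nonneg (norm_nonneg _)).mpr fun i => ?_
      have := norm_le_pi_norm (fun a => q (e a)) (e.symm i)
      simpa using this
  have h1 := hY z _ hq'
  have h2 : S (linForms (Ξ Y) p q)
      = fun k => ∑ a, (q (e a) : ℝ) * Y a k - Sum.elim (fun a => (z a : ℝ)) 0 k := by
    rw [linForms_eq, map_sub, hz, map_sum]
    ext k
    rw [Pi.sub_apply, Finset.sum_apply]
    congr 1
    rw [← e.sum_comp]
    refine Finset.sum_congr rfl fun a _ => ?_
    rw [map_smul, hΞ]
    simp
  have h3 := hSK (linForms (Ξ Y) p q)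
  have hexp : -(((r + M : ℕ) : ℝ) + (latticeDim A : ℝ)) / (n : ℝ) + 1
      = -((Fintype.card (Fin M) : ℝ) / Fintype.card (Fin (latticeDim A) ⊕ Fin r)) := by
    have hnR : (n : ℝ) = (latticeDim A : ℝ) + r := by exact_mod_cast hr.symm
    have hn0 : (latticeDim A : ℝ) + r ≠ 0 := by
      rw [← hnR]
      positivity
    simp only [Fintype.card_sum, Fintype.card_fin]
    push_cast
    rw [hnR]
    field_simp
    ring
  rw [neg_div] at hexp
  have hpos : 0 < ‖q‖ ^ (-((Fintype.card (Fin M) : ℝ) /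
      Fintype.card (Fin (latticeDim A) ⊕ Fin r))) := Real.rpow_pos_of_pos (norm_pos_iff.mpr hq) _
  rw [hnorm, ← h2] at h1
  have h4 := h1.trans h3
  change _ < ‖linForms (Ξ Y) p q‖
  rw [hexp, div_mul_eq_mul_div, div_lt_iff₀ (by positivity)]
  have h5 := mul_pos hC hpos
  nlinarith

lemma dimH_BadA (A : AddSubgroup (Fin n → ℤ)) (hn : 0 < n) :
    dimH (BadA m n A) = ((m * n : ℕ) : ENNReal) := by
  refine le_antisymm (dimH_matrices_le _) ?_
  rcases le_or_gt (m + latticeDim A) n with hA | hA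
  · refine le_dimH_of_volume_ne_zero ?_
    rw [measure_congr (ae_eq_univ.mpr (ae_iff.mp (ae_mem_BadA A hA)))]
    exact NeZero.ne _
  · exact le_dimH_BadA_of_lt A hn hA

end ManyForms

/-! ### Matrices in the unit cube without shifts -/

section Star

variable {m n : ℕ}

lemma latticeDim_bot : latticeDim (⊥ : AddSubgroup (Fin n → ℤ)) = 0 := by
  have h : (fun (v : Fin n → ℤ) (j : Fin n) => (v j : ℝ)) ''
      ((⊥ : AddSubgroup (Fin n → ℤ)) : Set (Fin n → ℤ)) = {0} := by
    rw [AddSubgroup.coe_bot, Set.image_singleton]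
    congr 1
    ext j
    simp
  rw [latticeDim, h, Submodule.span_zero_singleton, finrank_bot]

lemma le_dimH_BadStar_of_le (hmn : m ≤ n) : ((m * n : ℕ) : ENNReal) ≤ dimH (BadStar m n) := by
  have hae := ae_mem_BadA (m := m) (⊥ : AddSubgroup (Fin n → ℤ)) (by rw [latticeDim_bot]; omega)
  have hcube : volume (Set.Icc (0 : Fin m → Fin n → ℝ) 1) ≠ 0 := by
    have h1 : (Set.Icc (0 : Fin m → Fin n → ℝ) 1)
        = Set.univ.pi fun _ => Set.univ.pi fun _ => Set.Icc 0 1 := by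
      ext X
      simp only [Set.mem_Icc, Pi.le_def, Set.mem_pi, Set.mem_univ, true_imp_iff, Pi.zero_apply,
        Pi.one_apply, forall_and]
    rw [h1, volume_pi_pi]
    refine Finset.prod_ne_zero_iff.mpr fun i _ => ?_
    rw [volume_pi_pi]
    exact Finset.prod_ne_zero_iff.mpr fun j _ => by simp
  have hsub : BadA m n ⊥ ∩ Set.Icc 0 1 ⊆ BadStar m n := by
    rintro X ⟨⟨C, hC, h⟩, h0, h1⟩
    refine ⟨fun i j => ⟨h0 i j, h1 i j⟩, C, hC, fun q hq => ?_⟩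
    have := h 0 (zero_mem _) q hq
    rw [latticeDim_bot, Nat.cast_zero, add_zero] at this
    refine this.trans_eq ?_
    congr 1
    unfold linForms
    ext j
    simp
  refine (le_dimH_of_volume_ne_zero ?_).trans (dimH_mono hsub)
  rwa [Measure.measure_inter_eq_of_ae hae]

lemma le_dimH_BadStar_of_lt (hn : 0 < n) (hmn : n < m) :
    ((m * n : ℕ) : ENNReal) ≤ dimH (BadStar m n) := by
  obtain ⟨M, rfl⟩ : ∃ M, m = n + M := Nat.exists_eq_add_of_le hmn.le
  have : Nonempty (Fin n) := ⟨⟨0, hn⟩⟩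
  have : Nonempty (Fin M) := ⟨⟨0, by omega⟩⟩
  have hdim := le_dimH_badFamily (α := Fin 0) (ρ := Fin n) (μ := Fin M)
  let e : Fin n ⊕ Fin M ≃ Fin (n + M) := finSumFinEquiv
  let f : Fin n ≃ Fin 0 ⊕ Fin n := (Equiv.emptySum (Fin 0) (Fin n)).symm
  have hf : ∀ j, f j = Sum.inr j := fun _ => rfl
  -- the entries of the family lie in `[0, K]`
  set K : ℝ := 2 * n + 2 with hK
  have hK0 : 0 < K := by positivity
  let Ξ : (Fin n ⊕ Fin M → Fin 0 ⊕ Fin n → ℝ) ≃ₗ[ℝ] (Fin (n + M) → Fin n → ℝ) :=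
    (LinearEquiv.smulOfNeZero ℝ _ K⁻¹ (inv_ne_zero hK0.ne')).trans
      ((LinearEquiv.piCongrRight fun _ => LinearEquiv.funCongrLeft ℝ ℝ f).trans
        (LinearEquiv.funCongrLeft ℝ _ e.symm))
  have hΞ : ∀ Y i j, Ξ Y i j = K⁻¹ * Y (e.symm i) (Sum.inr j) := fun _ _ _ => rfl
  rw [← Ξ.toContinuousLinearEquiv.dimH_image] at hdim
  simp only [Fintype.card_sum, Fintype.card_fin, zero_add] at hdim
  refine hdim.trans (dimH_mono ?_)
  rintro _ ⟨Y, ⟨hent, C, hC, hY⟩, rfl⟩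
  change Ξ Y ∈ BadStar (n + M) n
  refine ⟨fun i j => ?_, C / (2 * K), by positivity, fun q hq => ?_⟩
  · rw [hΞ]
    have h1 := hent (e.symm i) (Sum.inr j)
    rw [Fintype.card_fin] at h1
    refine ⟨mul_nonneg (inv_nonneg.mpr hK0.le) h1.1, ?_⟩
    rw [inv_mul_le_iff₀ hK0, mul_one]
    exact h1.2
  have hq' : (fun a => q (e a)) ≠ 0 := by
    intro h
    refine hq (funext fun i => ?_)
    have := congrFun h (e.symm i)
    simpa using this
  have hnorm : ‖q‖ ≤ ‖fun a => q (e a)‖ ∧ ‖fun a => q (e a)‖ ≤ ‖q‖ := by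
    refine ⟨?_, ?_⟩
    · refine (pi_norm_le_iff_of_nonneg (norm_nonneg _)).mpr fun i => ?_
      have := norm_le_pi_norm (fun a => q (e a)) (e.symm i)
      simpa using this
    · exact (pi_norm_le_iff_of_nonneg (norm_nonneg _)).mpr fun a => norm_le_pi_norm q (e a)
  have h1 := hY (fun a => a.elim0) _ hq'
  rw [le_antisymm hnorm.2 hnorm.1] at h1
  have h2 : ‖fun k => ∑ a, (q (e a) : ℝ) * Y a k
      - Sum.elim (fun a : Fin 0 => ((a.elim0 : ℤ) : ℝ)) 0 k‖
      ≤ K * ‖Matrix.vecMul (fun i => (q i : ℝ)) (Matrix.of (Ξ Y))‖ := by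
    refine (pi_norm_le_iff_of_nonneg (by positivity)).mpr fun k => ?_
    rcases k with a | j
    · exact a.elim0
    have h3 : ∑ a, (q (e a) : ℝ) * Y a (Sum.inr j)
        = K * Matrix.vecMul (fun i => (q i : ℝ)) (Matrix.of (Ξ Y)) j := by
      simp only [Matrix.vecMul, dotProduct, Matrix.of_apply, hΞ]
      rw [← e.sum_comp, Finset.mul_sum]
      refine Finset.sum_congr rfl fun a _ => ?_
      rw [Equiv.symm_apply_apply]
      field_simp
    simp only [Sum.elim_inr, Pi.zero_apply, sub_zero]
    rw [h3, norm_mul, Real.norm_of_nonneg hK0.le]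
    exact mul_le_mul_of_nonneg_left (norm_le_pi_norm _ j) hK0.le
  have hexp : -(((n + M : ℕ) : ℝ) / (n : ℝ)) + 1
      = -((Fintype.card (Fin M) : ℝ) / Fintype.card (Fin 0 ⊕ Fin n)) := by
    have hn0 : (n : ℝ) ≠ 0 := by positivity
    simp only [Fintype.card_sum, Fintype.card_fin, zero_add]
    push_cast
    field_simp
    ring
  have hpos : 0 < ‖q‖ ^ (-((Fintype.card (Fin M) : ℝ) / Fintype.card (Fin 0 ⊕ Fin n))) :=
    Real.rpow_pos_of_pos (norm_pos_iff.mpr hq) _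
  rw [hexp, div_mul_eq_mul_div, div_lt_iff₀ (by positivity)]
  have h4 := h1.trans h2
  have h5 := mul_pos hC hpos
  nlinarith

lemma dimH_BadStar (hn : 0 < n) : dimH (BadStar m n) = ((m * n : ℕ) : ENNReal) := by
  refine le_antisymm (dimH_matrices_le _) ?_
  rcases le_or_gt m n with h | h
  · exact le_dimH_BadStar_of_le h
  · exact le_dimH_BadStar_of_lt hn h

end Star

theorem theorem1 (m n : ℕ) (hm : 0 < m) (hn : 0 < n) :
    (∀ A : AddSubgroup (Fin n → ℤ),
      dimH (BadA m n A) = ((m * n : ℕ) : ENNReal) ∧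
      (m + latticeDim A ≤ n →
        (∀ᵐ X ∂(volume : Measure (Fin m → Fin n → ℝ)), X ∈ BadA m n A) ∧
        (∀ᵐ X ∂(volume : Measure (Fin m → Fin n → ℝ)),
          ∃ C : ℝ, 0 < C ∧ ∀ p ∈ A, ∀ q : Fin m → ℤ, q ≠ 0 →
            C * ‖q‖ < ‖linForms X p q‖))) ∧
    dimH (BadStar m n) = ((m * n : ℕ) : ENNReal) :=
  ⟨fun A => ⟨dimH_BadA A hn, fun hA => ⟨ae_mem_BadA A hA, ae_exists_mul_norm_lt A hA⟩⟩,
    dimH_BadStar hn⟩
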